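/- Let $\mathbb F=\mathbb R$ or $\mathbb C$, let $N\ge 1$, and let $\mathcal D$ be a dyadic lattice in $\mathbb R^N$: for every $k\in\mathbb Z$ it contains the half-open cubes of side $2^{-k}$ of a grid tiling $\mathbb R^N$, and the grid of generation $k+1$ refines the grid of generation $k$ (this includes all translates of the standard dyadic lattice). Write $\langle f\rangle_Q=|Q|^{-1}\int_Q f\,dx$, and let $\|\cdot\|$ denote the operator norm of a matrix with respect to the Euclidean norm. A $d\times d$ matrix weight is a locally integrable function on $\mathbb R^N$ whose values are positive-semidefinite matrices over $\mathbb F$. For matrix weights $V,W$ put $$[W,V]_{\mathbf A_2}=\sup_{Q\in\mathcal D}\bigl\|\langle W\rangle_Q^{1/2}\langle V\rangle_Q^{1/2}\bigr\|^2 .$$ For a scalar weight $w\ge 0$ let $[w]_{A_\infty}$ be the best constant $K$ in $\langle M_Qw\rangle_Q\le K\langle w\rangle_Q$ for all $Q\in\mathcal D$, where $M_Qw(x)=\sup\{|\langle w\rangle_R| : R\in\mathcal D,\ R\subset Q,\ x\in R\}$ (and $M_Qw(x)=0$ for $x\notin Q$). Put $$[W]^{\mathrm{sc}}_{A_\infty}=\sup_{e\in\mathbb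 F^d}[w_e]_{A_\infty},\qquad w_e(x)=(W(x)e,e).$$ For a family $\mathcal S\subset\mathcal D$ define, for real-valued $f$, the scalar Lerner operator $$\widetilde L f(x)=\sum_{Q\in\mathcal S}\bigl\langle\|V(x)^{1/2}W^{1/2}\|\cdot|f|\bigr\rangle_Q\,\mathbf 1_Q(x).$$ The family $\mathcal S$ is called $\kappa$-sparse ($0<\kappa<1$) if for every $Q\in\mathcal S$ one has $\sum_{R}|R|\le\kappa|Q|$, where the sum is over the maximal elements $R$ of $\mathcal S$ strictly contained in $Q$; it is called $\lambda$-Carleson ($\lambda>0$) if $\sum_{R\in\mathcal S,\,R\subset Q}|R|\le\lambda|Q|$ for every $Q\in\mathcal S$. **Lemma.** There is an absolute constant $C>0$ (independent of $N$, $d$, $\mathbb F$, $\mathcal D$, $\mathcal S$, $\kappa$, $\lambda$, $V$, $W$) such that the following holds. Let $V,W$ be $d\times d$ matrix weights on $\mathbb R^N$ with $[W,V]_{\mathbf A_2}<\infty$, $[W]^{\mathrm{sc}}_{A_\infty}<\infty$ and $[V]^{\mathrm{sc}}_{A_\infty}<\infty$, and let $\mathcal S\subset\mathcal D$. (i) If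 $\mathcal S$ is $\kappa$-sparse, $0<\kappa<1$, then $\widetilde L$ maps $L^2(\mathbb R^N)$ to $L^2(\mathbb R^N)$ and $$\|\widetilde L\|_{L^2\to L^2}\le\frac{C}{1-\kappa}\,2^N d\,[W,V]_{\mathbf A_2}^{1/2}\,\bigl([W]^{\mathrm{sc}}_{A_\infty}\bigr)^{1/2}\bigl([V]^{\mathrm{sc}}_{A_\infty}\bigr)^{1/2},$$ i.e. $\|\widetilde Lf\|_{L^2}$ is at most this quantity times $\|f\|_{L^2}$ for every $f\in L^2$. (ii) If $\mathcal S$ is $\lambda$-Carleson, $\lambda>0$, then $\widetilde L$ maps $L^2(\mathbb R^N)$ to $L^2(\mathbb R^N)$ and $$\|\widetilde L\|_{L^2\to L^2}\le C\lambda\,2^N d\,[W,V]_{\mathbf A_2}^{1/2}\,\bigl([W]^{\mathrm{sc}}_{A_\infty}\bigr)^{1/2}\bigl([V]^{\mathrm{sc}}_{A_\infty}\bigr)^{1/2}.$$ -/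

import Mathlib

open MeasureTheory
open scoped ENNReal ComplexOrder Matrix MatrixOrder Matrix.Norms.L2Operator

/-- A dyadic lattice in `ℝ^N`: for each generation `k : ℤ` the space is tiled by half-open cubes of
side `2 ^ (-k)`, and the grid of generation `k + 1` refines the grid of generation `k`.
All translations of the standard dyadic lattice are of this form (take `origin` constant), and so
are the "generation-wise translated" lattices. -/
structure DyadicLattice (N : ℕ) where
  /-- A vertex of the grid of generation `k`. -/
  origin : ℤ → Fin N → ℝ
  /-- The vertices of generation `k` are among those of generation `k + 1`. -/
  nested : ∀ (k : ℤ) (i : Fin N), ∃ m : ℤ, origin k i = origin (k + 1) i + m * (2 : ℝ) ^ (-(k + 1))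

namespace DyadicLattice

variable {N : ℕ}

/-- The half-open cube of generation `k` (side `2 ^ (-k)`) with position `m`. -/
def cube (D : DyadicLattice N) (k : ℤ) (m : Fin N → ℤ) : Set (EuclideanSpace ℝ (Fin N)) :=
  {x | ∀ i, x i ∈ Set.Ico (D.origin k i + m i * (2 : ℝ) ^ (-k))
    (D.origin k i + (m i + 1) * (2 : ℝ) ^ (-k))}

/-- The set of all cubes of the lattice. -/
def cubes (D : DyadicLattice N) : Set (Set (EuclideanSpace ℝ (Fin N))) :=
  {Q | ∃ k m, Q = D.cube k m}

/-- The dyadic maximal function adapted to `Q`: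
`M_Q w (x) = sup { |⟨w⟩_R| : R ∈ D, R ⊆ Q, x ∈ R }` (it is `0` outside `Q`). -/
noncomputable def maximal (D : DyadicLattice N) (Q : Set (EuclideanSpace ℝ (Fin N)))
    (w : EuclideanSpace ℝ (Fin N) → ℝ) (x : EuclideanSpace ℝ (Fin N)) : ℝ≥0∞ :=
  ⨆ R ∈ {R | R ∈ D.cubes ∧ R ⊆ Q ∧ x ∈ R}, ENNReal.ofReal |⨍ y in R, w y|

/-- The dyadic `A_∞` characteristic of a scalar weight `w`: the best constant `C` in
`⟨M_Q w⟩_Q ≤ C ⟨w⟩_Q`, `Q ∈ D` (it is `∞` if there is no finite one). -/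
noncomputable def aInfty (D : DyadicLattice N) (w : EuclideanSpace ℝ (Fin N) → ℝ) : ℝ≥0∞ :=
  sInf {C : ℝ≥0∞ | ∀ Q ∈ D.cubes,
    (⨍⁻ x in Q, D.maximal Q w x ∂volume) ≤ C * ENNReal.ofReal (⨍ x in Q, w x)}

end DyadicLattice

section Weights

variable {N d : ℕ} {𝕜 : Type} [RCLike 𝕜]

/-- A `d × d` matrix weight on `ℝ^N`: a locally integrable function whose values are
positive-semidefinite matrices. -/
structure IsMatrixWeight (W : EuclideanSpace ℝ (Fin N) → Matrix (Fin d) (Fin d) 𝕜) : Prop where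
  posSemidef : ∀ x, (W x).PosSemidef
  locallyIntegrable : ∀ i j, LocallyIntegrable (fun x => W x i j) volume

/-- The (entrywise) average `⟨W⟩_Q` of a matrix-valued function. -/
noncomputable def matrixAverage (W : EuclideanSpace ℝ (Fin N) → Matrix (Fin d) (Fin d) 𝕜)
    (Q : Set (EuclideanSpace ℝ (Fin N))) : Matrix (Fin d) (Fin d) 𝕜 :=
  Matrix.of fun i j => ⨍ x in Q, W x i j

/-- The joint dyadic matrix `A_2` characteristic
`[W, V] = sup_{Q ∈ D} ‖⟨W⟩_Q^{1/2} ⟨V⟩_Q^{1/2}‖ ^ 2`; here `‖·‖` is the operator norm with respect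
to the Euclidean norm. -/
noncomputable def jointA2 (D : DyadicLattice N)
    (W V : EuclideanSpace ℝ (Fin N) → Matrix (Fin d) (Fin d) 𝕜) : ℝ≥0∞ :=
  ⨆ Q ∈ D.cubes,
    ENNReal.ofReal (‖CFC.sqrt (matrixAverage W Q) * CFC.sqrt (matrixAverage V Q)‖ ^ 2)

/-- The scalar weight `w_e(x) = (W(x) e, e)`. -/
noncomputable def scalarWeight (W : EuclideanSpace ℝ (Fin N) → Matrix (Fin d) (Fin d) 𝕜)
    (e : Fin d → 𝕜) (x : EuclideanSpace ℝ (Fin N)) : ℝ :=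
  RCLike.re (star e ⬝ᵥ (W x *ᵥ e))

/-- The scalar dyadic `A_∞` characteristic of a matrix weight: `sup_e [w_e]_{A_∞}`. -/
noncomputable def scalarAInfty (D : DyadicLattice N)
    (W : EuclideanSpace ℝ (Fin N) → Matrix (Fin d) (Fin d) 𝕜) : ℝ≥0∞ :=
  ⨆ e : Fin d → 𝕜, D.aInfty (scalarWeight W e)

/-- The scalar Lerner operator
`L f (x) = ∑_{Q ∈ S} ⟨‖V(x)^{1/2} W^{1/2}‖ |f|⟩_Q 1_Q(x)`. It is a sum of nonnegative terms, so it is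
defined everywhere as a function with values in `[0, ∞]`. -/
noncomputable def scalarLerner (S : Set (Set (EuclideanSpace ℝ (Fin N))))
    (V W : EuclideanSpace ℝ (Fin N) → Matrix (Fin d) (Fin d) 𝕜)
    (f : EuclideanSpace ℝ (Fin N) → ℝ) (x : EuclideanSpace ℝ (Fin N)) : ℝ≥0∞ :=
  ∑' Q : S, (Q : Set (EuclideanSpace ℝ (Fin N))).indicator
    (fun x => ⨍⁻ y in (Q : Set (EuclideanSpace ℝ (Fin N))),
      ENNReal.ofReal (‖CFC.sqrt (V x) * CFC.sqrt (W y)‖ * |f y|) ∂volume) x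

end Weights

section Sparse

variable {N : ℕ}

/-- `S` is `lam`-Carleson: `∑_{R ∈ S, R ⊆ Q} |R| ≤ lam |Q|` for every `Q ∈ S`. -/
def IsDyadicCarleson (lam : ℝ) (S : Set (Set (EuclideanSpace ℝ (Fin N)))) : Prop :=
  ∀ Q ∈ S, ∑' R : {R | R ∈ S ∧ R ⊆ Q}, volume (R : Set (EuclideanSpace ℝ (Fin N)))
    ≤ ENNReal.ofReal lam * volume Q

/-- The `S`-children of `Q`: the maximal elements of `S` strictly contained in `Q`. -/
def sparseChildren (S : Set (Set (EuclideanSpace ℝ (Fin N))))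
    (Q : Set (EuclideanSpace ℝ (Fin N))) : Set (Set (EuclideanSpace ℝ (Fin N))) :=
  {R | Maximal (fun R => R ∈ S ∧ R ⊂ Q) R}

/-- `S` is `κ`-sparse: `∑_{R ∈ ch_S Q} |R| ≤ κ |Q|` for every `Q ∈ S`. -/
def IsClassicallySparse (κ : ℝ) (S : Set (Set (EuclideanSpace ℝ (Fin N)))) : Prop :=
  ∀ Q ∈ S, ∑' R : sparseChildren S Q, volume (R : Set (EuclideanSpace ℝ (Fin N)))
    ≤ ENNReal.ofReal κ * volume Q

end Sparse

/-! Where the averages over `Q` are invertible one may write `V(x)^{1/2} W(y)^{1/2} =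
V(x)^{1/2}⟨V⟩_Q^{-1/2} · ⟨V⟩_Q^{1/2}⟨W⟩_Q^{1/2} · ⟨W⟩_Q^{-1/2} W(y)^{1/2}`. The middle factor costs
`[W,V]^{1/2}`. The operator norm of an outer factor is at most its Frobenius norm, which is the
square root of a sum of `d` scalar weights `v_{e_i}(x)`, resp. `w_{g_i}(y)`, where `e_i`, `g_i`
depend on `Q`, the averages over `Q` are at most `1`, and the `A_∞` constants are at most those of
`V`, `W`. Singular averages are replaced by `⟨V⟩_Q + δ`, `⟨W⟩_Q + δ`, at the price of an arbitrarily
small `η` (`Matrix.exists_sqrt_mul_sqrt_factor`).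

Hence a finite part of the operator is dominated pointwise by `T = K^{1/2} ∑ c_Q r_Q 1_Q` with `c_Q
= ⟨(∑ w_{g_i})^{1/2}|f|⟩_Q` and `r_Q = (∑ v_{e_i})^{1/2}`. Testing `T` against itself gives `∫T² =
K^{1/2} ∑ |Q| c_Q b_Q` with `b_Q = ⟨r_Q T⟩_Q`. Cauchy–Schwarz leaves two sums of the same type, each
bounded by `carleson_embedding_sqrt_sum`; the finite quantity `(∫T²)^{1/2}` then cancels, and finite
families exhaust `S` by monotone convergence.

The linear dependence on `A_∞` comes from `carleson_embedding_sqrt_sum`. By `reverse_holder` the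
weights are uniformly in `L^{1+ε}` on `Q` with `ε ~ 1/(2^N A)`. Hölder replaces `⟨u^{1/2} f⟩_Q²` by
`⟨f^p⟩_Q^q` with `pq = 2` and `q - 1 ~ ε`, and the `L^q` Carleson embedding costs `q/(q-1) ~ 2^N A`.
Each embedding has constant `64·2^N d A λ`, and taking square roots of both leaves `64·2^N d λ (A_W
A_V)^{1/2}`. A `κ`-sparse family is the case `λ = 1/(1-κ)`. -/

namespace DyadicLattice

/-! ### Geometry of dyadic cubes. -/

section Geometry

variable {N : ℕ} (D : DyadicLattice N)

/-- The position of the cube of generation `k` containing `x`. -/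
noncomputable def index (k : ℤ) (x : EuclideanSpace ℝ (Fin N)) (i : Fin N) : ℤ :=
  ⌊(x i - D.origin k i) / (2 : ℝ) ^ (-k)⌋

lemma mem_cube_iff {k : ℤ} {m : Fin N → ℤ} {x : EuclideanSpace ℝ (Fin N)} :
    x ∈ D.cube k m ↔ D.index k x = m := by
  have hs : (0 : ℝ) < (2 : ℝ) ^ (-k) := by positivity
  simp only [cube, Set.mem_ofPred_eq, Set.mem_Ico, funext_iff, index, Int.floor_eq_iff,
    le_div_iff₀ hs, div_lt_iff₀ hs]
  refine forall_congr' fun i => ?_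
  constructor <;> rintro ⟨h1, h2⟩ <;> constructor <;> linarith

lemma index_succ {k : ℤ} {x y : EuclideanSpace ℝ (Fin N)} (h : D.index (k + 1) x = D.index (k + 1) y) :
    D.index k x = D.index k y := by
  funext i
  obtain ⟨M, hM⟩ := D.nested k i
  have hi := congrFun h i
  have hs : (0 : ℝ) < (2 : ℝ) ^ (-(k + 1)) := by positivity
  have h2 : (2 : ℝ) ^ (-k) = 2 * (2 : ℝ) ^ (-(k + 1)) := by
    rw [show -k = 1 + -(k + 1) by ring, zpow_add₀ (by norm_num), zpow_one]
  -- Passing to the coarser grid is integer division of positions by `2` after the shift `M`, so the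
  -- finer position determines the coarser one.
  have key : ∀ z : EuclideanSpace ℝ (Fin N),
      D.index k z i = (D.index (k + 1) z i - M) / 2 := by
    intro z
    simp only [index]
    set u := (z i - D.origin (k + 1) i) / (2 : ℝ) ^ (-(k + 1)) with hu
    have : (z i - D.origin k i) / (2 : ℝ) ^ (-k) = (u - M) / 2 := by
      rw [hu, hM, h2]; field_simp; ring
    rw [this, Int.floor_eq_iff]
    have h1 := Int.floor_le u
    have h3 := Int.lt_floor_add_one u
    have h4 : 2 * ((⌊u⌋ - M) / 2) ≤ ⌊u⌋ - M := by omega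
    have h5 : ⌊u⌋ - M + 1 ≤ 2 * ((⌊u⌋ - M) / 2) + 2 := by omega
    have h4' : (2 : ℝ) * (((⌊u⌋ - M) / 2 : ℤ) : ℝ) ≤ ⌊u⌋ - M := by exact_mod_cast h4
    have h5' : (⌊u⌋ : ℝ) - M + 1 ≤ 2 * (((⌊u⌋ - M) / 2 : ℤ) : ℝ) + 2 := by exact_mod_cast h5
    constructor <;> linarith
  rw [key, key, hi]

lemma index_mono {k l : ℤ} (hkl : k ≤ l) {x y : EuclideanSpace ℝ (Fin N)}
    (h : D.index l x = D.index l y) : D.index k x = D.index k y := by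
  obtain ⟨n, rfl⟩ := Int.le.dest hkl
  induction n with
  | zero => simpa using h
  | succ n ih =>
    refine ih (by omega) (D.index_succ ?_)
    push_cast at h
    rwa [add_assoc]

lemma cube_subset_cube {k l : ℤ} (hkl : k ≤ l) {m m' : Fin N → ℤ} {x : EuclideanSpace ℝ (Fin N)}
    (hx : x ∈ D.cube k m) (hx' : x ∈ D.cube l m') : D.cube l m' ⊆ D.cube k m := by
  intro y hy
  rw [mem_cube_iff] at *
  rw [← hx]
  exact D.index_mono hkl (hy.trans hx'.symm)

lemma mem_cube_index (k : ℤ) (x : EuclideanSpace ℝ (Fin N)) : x ∈ D.cube k (D.index k x) :=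
  D.mem_cube_iff.2 rfl

lemma cube_mem_cubes (k : ℤ) (m : Fin N → ℤ) : D.cube k m ∈ D.cubes := ⟨k, m, rfl⟩

lemma cube_nonempty (k : ℤ) (m : Fin N → ℤ) : (D.cube k m).Nonempty := by
  refine ⟨WithLp.toLp 2 fun i => D.origin k i + m i * (2 : ℝ) ^ (-k), fun i => ?_⟩
  have hs : (0 : ℝ) < (2 : ℝ) ^ (-k) := by positivity
  simp only [Set.mem_Ico, le_refl, true_and]
  nlinarith

lemma countable_cubes : D.cubes.Countable := by
  have : D.cubes = Set.range fun p : ℤ × (Fin N → ℤ) => D.cube p.1 p.2 := by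
    ext Q
    simp only [cubes, Set.mem_ofPred_eq, Set.mem_range, Prod.exists, eq_comm]
  rw [this]
  exact Set.countable_range _

lemma subset_or_subset {Q R : Set (EuclideanSpace ℝ (Fin N))} (hQ : Q ∈ D.cubes) (hR : R ∈ D.cubes)
    {x : EuclideanSpace ℝ (Fin N)} (hxQ : x ∈ Q) (hxR : x ∈ R) : Q ⊆ R ∨ R ⊆ Q := by
  obtain ⟨k, m, rfl⟩ := hQ
  obtain ⟨l, m', rfl⟩ := hR
  rcases le_total k l with h | h
  · exact Or.inr (D.cube_subset_cube h hxQ hxR)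
  · exact Or.inl (D.cube_subset_cube h hxR hxQ)

lemma cube_eq_preimage (k : ℤ) (m : Fin N → ℤ) :
    D.cube k m = (MeasurableEquiv.toLp 2 (Fin N → ℝ)).symm ⁻¹'
      (Set.pi Set.univ fun i => Set.Ico (D.origin k i + m i * (2 : ℝ) ^ (-k))
        (D.origin k i + (m i + 1) * (2 : ℝ) ^ (-k))) := by
  ext x
  simp [cube]

lemma measurableSet_cube (k : ℤ) (m : Fin N → ℤ) : MeasurableSet (D.cube k m) := by
  rw [cube_eq_preimage]
  exact (MeasurableEquiv.toLp 2 (Fin N → ℝ)).symm.measurable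
    (MeasurableSet.univ_pi fun i => measurableSet_Ico)

lemma measurableSet_of_mem {Q : Set (EuclideanSpace ℝ (Fin N))} (hQ : Q ∈ D.cubes) :
    MeasurableSet Q := by
  obtain ⟨k, m, rfl⟩ := hQ
  exact D.measurableSet_cube k m

lemma volume_cube (k : ℤ) (m : Fin N → ℤ) :
    volume (D.cube k m) = ENNReal.ofReal ((2 : ℝ) ^ (-k)) ^ N := by
  rw [cube_eq_preimage, (EuclideanSpace.volume_preserving_symm_measurableEquiv_toLp
    (Fin N)).measure_preimage (MeasurableSet.univ_pi fun i => measurableSet_Ico).nullMeasurableSet,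
    Real.volume_pi_Ico]
  have : ∀ i : Fin N, D.origin k i + (m i + 1) * (2 : ℝ) ^ (-k) -
      (D.origin k i + m i * (2 : ℝ) ^ (-k)) = (2 : ℝ) ^ (-k) := fun i => by ring
  simp only [this]
  simp

lemma volume_ne_zero {Q : Set (EuclideanSpace ℝ (Fin N))} (hQ : Q ∈ D.cubes) : volume Q ≠ 0 := by
  obtain ⟨k, m, rfl⟩ := hQ
  rw [volume_cube]
  refine pow_ne_zero _ ?_
  simpa using zpow_pos (by norm_num : (0 : ℝ) < 2) (-k)

lemma volume_ne_top {Q : Set (EuclideanSpace ℝ (Fin N))} (hQ : Q ∈ D.cubes) : volume Q ≠ ∞ := by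
  obtain ⟨k, m, rfl⟩ := hQ
  rw [volume_cube]
  exact ENNReal.pow_ne_top ENNReal.ofReal_ne_top

lemma isBounded_of_mem {Q : Set (EuclideanSpace ℝ (Fin N))} (hQ : Q ∈ D.cubes) :
    Bornology.IsBounded Q := by
  obtain ⟨k, m, rfl⟩ := hQ
  have hc : IsCompact (Set.pi Set.univ fun i : Fin N =>
      Set.Icc (D.origin k i + m i * (2 : ℝ) ^ (-k)) (D.origin k i + (m i + 1) * (2 : ℝ) ^ (-k))) :=
    isCompact_univ_pi fun i => isCompact_Icc
  refine (hc.image (PiLp.continuous_toLp 2 fun _ : Fin N => ℝ)).isBounded.subset ?_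
  intro x hx
  exact ⟨WithLp.ofLp x, fun i _ => Set.Ico_subset_Icc_self (hx i), rfl⟩

lemma exists_parent {R Q : Set (EuclideanSpace ℝ (Fin N))} (hR : R ∈ D.cubes) (hQ : Q ∈ D.cubes)
    (hRQ : R ⊂ Q) :
    ∃ P ∈ D.cubes, R ⊆ P ∧ P ⊆ Q ∧ volume P = 2 ^ N * volume R := by
  obtain ⟨k, m, rfl⟩ := hR
  obtain ⟨l, m', rfl⟩ := hQ
  obtain ⟨x, hx⟩ := D.cube_nonempty k m
  have hlk : l < k := by
    by_contra! h
    exact hRQ.2 (D.cube_subset_cube h hx (hRQ.1 hx))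
  refine ⟨_, D.cube_mem_cubes (k - 1) (D.index (k - 1) x),
    D.cube_subset_cube (by omega) (D.mem_cube_index _ x) hx,
    D.cube_subset_cube (by omega) (hRQ.1 hx) (D.mem_cube_index _ x), ?_⟩
  rw [volume_cube, volume_cube, ← mul_pow, show -(k - 1) = 1 + -k by ring,
    zpow_add₀ (by norm_num), zpow_one, ENNReal.ofReal_mul (by norm_num)]
  simp

lemma finite_between (R Q : Set (EuclideanSpace ℝ (Fin N))) (hR : R ∈ D.cubes) (hQ : Q ∈ D.cubes) :
    {P | P ∈ D.cubes ∧ R ⊆ P ∧ P ⊆ Q}.Finite := by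
  obtain ⟨k, m, rfl⟩ := hR
  obtain ⟨l, m', rfl⟩ := hQ
  obtain ⟨x, hx⟩ := D.cube_nonempty k m
  -- A cube presented with a generation outside `[l, k]` must coincide with one of the two end
  -- cubes, so these are added by hand.
  refine (((Set.finite_Icc l k).image fun j => D.cube j (D.index j x)).union
    (Set.toFinite {D.cube k m, D.cube l m'})).subset ?_
  rintro P ⟨⟨j, n, rfl⟩, h1, h2⟩
  by_cases hj : j ∈ Set.Icc l k
  · refine Or.inl ⟨j, hj, ?_⟩
    simp only [D.mem_cube_iff.1 (h1 hx)]
  · right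
    rw [Set.mem_Icc, not_and_or, not_le, not_le] at hj
    rcases hj with hj | hj
    · exact Or.inr (h2.antisymm (D.cube_subset_cube hj.le (h1 hx) (h2 (h1 hx))))
    · exact Or.inl ((D.cube_subset_cube hj.le hx (h1 hx)).antisymm h1)

/-- Every cube in a family of subcubes of `Q` lies in a maximal one. -/
lemma exists_le_maximal {Q R : Set (EuclideanSpace ℝ (Fin N))} (hQ : Q ∈ D.cubes)
    {p : Set (EuclideanSpace ℝ (Fin N)) → Prop} (hp : ∀ P, p P → P ∈ D.cubes ∧ P ⊆ Q) (hR : p R) :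
    ∃ P, R ⊆ P ∧ Maximal p P := by
  have hfin : {P | p P ∧ R ⊆ P}.Finite :=
    (D.finite_between R Q (hp R hR).1 hQ).subset fun P hP => ⟨(hp P hP.1).1, hP.2, (hp P hP.1).2⟩
  obtain ⟨P, hRP, hP⟩ := hfin.exists_le_maximal (a := R) ⟨hR, le_rfl⟩
  exact ⟨P, hRP, hP.1.1, fun P' hP' hPP' => hP.2 ⟨hP', hRP.trans hPP'⟩ hPP'⟩

/-- The maximal cubes of a family are pairwise disjoint. -/
lemma pairwiseDisjoint_maximal {p : Set (EuclideanSpace ℝ (Fin N)) → Prop}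
    (hp : ∀ P, p P → P ∈ D.cubes) : {P | Maximal p P}.PairwiseDisjoint id := by
  intro P hP R hR hPR
  rw [Function.onFun, id, id, Set.disjoint_left]
  intro x hxP hxR
  rcases D.subset_or_subset (hp P hP.1) (hp R hR.1) hxP hxR with h | h
  · exact hPR (hP.eq_of_le hR.1 h)
  · exact hPR (hR.eq_of_le hP.1 h).symm

end Geometry

/-! ### The dyadic maximal function and Lebesgue differentiation along cubes. -/

section Differentiation

variable {N : ℕ} (D : DyadicLattice N)

/-- The dyadic maximal function adapted to `Q` of a function with values in `[0, ∞]`. -/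
noncomputable def lmaximal (Q : Set (EuclideanSpace ℝ (Fin N)))
    (w : EuclideanSpace ℝ (Fin N) → ℝ≥0∞) (x : EuclideanSpace ℝ (Fin N)) : ℝ≥0∞ :=
  ⨆ R ∈ {R | R ∈ D.cubes ∧ R ⊆ Q ∧ x ∈ R}, (∫⁻ y in R, w y) / volume R

lemma le_lmaximal {Q R : Set (EuclideanSpace ℝ (Fin N))} (hR : R ∈ D.cubes) (hRQ : R ⊆ Q)
    (w : EuclideanSpace ℝ (Fin N) → ℝ≥0∞) {x : EuclideanSpace ℝ (Fin N)} (hx : x ∈ R) :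
    (∫⁻ y in R, w y) / volume R ≤ D.lmaximal Q w x :=
  le_iSup₂ (f := fun R _ => (∫⁻ y in R, w y) / volume R) R ⟨hR, hRQ, hx⟩

lemma lt_lmaximal_iff {Q : Set (EuclideanSpace ℝ (Fin N))}
    {w : EuclideanSpace ℝ (Fin N) → ℝ≥0∞} {x : EuclideanSpace ℝ (Fin N)} {t : ℝ≥0∞} :
    t < D.lmaximal Q w x ↔
      ∃ R, R ∈ D.cubes ∧ R ⊆ Q ∧ x ∈ R ∧ t < (∫⁻ y in R, w y) / volume R := by
  simp only [lmaximal, lt_iSup_iff, Set.mem_ofPred_eq, exists_prop, and_assoc]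

/-- Up to a null set, a half-open cube is a closed ball of the sup norm, so the Vitali
differentiation theorem in `Fin N → ℝ` applies and is carried over by the measure-preserving
identification with Euclidean space. -/
lemma ae_tendsto_average_cube {w : EuclideanSpace ℝ (Fin N) → ℝ≥0∞} (hw : AEMeasurable w)
    (hfin : ∫⁻ y, w y ≠ ∞) :
    ∀ᵐ x, Filter.Tendsto (fun k : ℕ => (∫⁻ y in D.cube k (D.index k x), w y) /
      volume (D.cube k (D.index k x))) Filter.atTop (nhds (w x)) := by
  have hmp := EuclideanSpace.volume_preserving_symm_measurableEquiv_toLp (Fin N)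
  set e := (MeasurableEquiv.toLp 2 (Fin N → ℝ)).symm with he
  have hmp' := hmp.symm
  have hv : AEMeasurable (w ∘ e.symm) := AEMeasurable.comp_quasiMeasurePreserving hw hmp'.quasiMeasurePreserving
  have hvfin : ∫⁻ y, (w ∘ e.symm) y ≠ ∞ := by
    rw [← hmp.lintegral_comp_emb e.measurableEmbedding]
    simpa using hfin
  have h := (IsUnifLocDoublingMeasure.vitaliFamily (volume : Measure (Fin N → ℝ))
    1).ae_tendsto_lintegral_div hv hvfin
  filter_upwards [hmp.quasiMeasurePreserving.ae h] with x hx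
  let c : ℕ → Fin N → ℝ := fun k i =>
    D.origin k i + (D.index k x i + 1 / 2) * (2 : ℝ) ^ (-(k : ℤ))
  let r : ℕ → ℝ := fun k => (2 : ℝ) ^ (-(k : ℤ)) / 2
  have hr : ∀ k, 0 < r k := fun k => by positivity
  have hball : ∀ k, Metric.closedBall (c k) (r k) = Set.pi Set.univ fun i =>
      Set.Icc (D.origin k i + D.index k x i * (2 : ℝ) ^ (-(k : ℤ)))
        (D.origin k i + (D.index k x i + 1) * (2 : ℝ) ^ (-(k : ℤ))) := by
    intro k
    rw [closedBall_pi _ (hr k).le]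
    congr 1
    funext i
    rw [Real.closedBall_eq_Icc]
    congr 1 <;> simp only [c, r] <;> ring
  have hae : ∀ k : ℕ, (Metric.closedBall (c k) (r k) : Set (Fin N → ℝ)) =ᵐ[volume]
      Set.pi Set.univ fun i =>
      Set.Ico (D.origin k i + D.index k x i * (2 : ℝ) ^ (-(k : ℤ)))
        (D.origin k i + (D.index k x i + 1) * (2 : ℝ) ^ (-(k : ℤ))) := by
    intro k
    rw [hball]
    exact (Measure.ae_eq_set_pi fun _ _ => Ico_ae_eq_Icc).symm
  have hxmem : ∀ k : ℕ, e x ∈ Metric.closedBall (c k) (1 * r k) := by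
    intro k
    rw [one_mul, hball]
    intro i _
    exact Set.Ico_subset_Icc_self (D.mem_cube_index k x i)
  have hrlim : Filter.Tendsto r Filter.atTop (nhdsWithin 0 (Set.Ioi 0)) := by
    refine tendsto_nhdsWithin_iff.2 ⟨?_, Filter.Eventually.of_forall hr⟩
    have : r = fun k : ℕ => (1 / 2 : ℝ) ^ k / 2 := by
      funext k
      simp [r]
    rw [this]
    simpa using (tendsto_pow_atTop_nhds_zero_of_lt_one (by norm_num : (0 : ℝ) ≤ 1 / 2)
      (by norm_num)).div_const 2
  have hlim := hx.comp (IsUnifLocDoublingMeasure.tendsto_closedBall_filterAt volume c r hrlim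
    (Filter.Eventually.of_forall hxmem))
  have hwx : (w ∘ e.symm) (e x) = w x := by simp
  rw [hwx] at hlim
  refine hlim.congr fun k => ?_
  simp only [Function.comp_apply]
  rw [measure_congr (hae k), setLIntegral_congr (hae k), cube_eq_preimage,
    ← hmp.measure_preimage_equiv, ← hmp.setLIntegral_comp_preimage_emb e.measurableEmbedding]
  simp [he]

lemma ae_le_lmaximal {Q : Set (EuclideanSpace ℝ (Fin N))} (hQ : Q ∈ D.cubes)
    {w : EuclideanSpace ℝ (Fin N) → ℝ≥0∞} (hw : AEMeasurable w) (hfin : ∫⁻ y in Q, w y ≠ ∞) :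
    ∀ᵐ x, x ∈ Q → w x ≤ D.lmaximal Q w x := by
  have hQm := D.measurableSet_of_mem hQ
  -- Differentiation is stated for finite total mass, so `w` is cut off to `Q`; cubes of large
  -- generation around `x` lie in `Q` and do not see the cutoff.
  have h := D.ae_tendsto_average_cube (hw.indicator hQm) (by rwa [lintegral_indicator hQm])
  filter_upwards [h] with x hx hxQ
  rw [Set.indicator_of_mem hxQ] at hx
  refine le_of_tendsto hx ?_
  obtain ⟨k₀, m, rfl⟩ := hQ
  filter_upwards [Filter.eventually_ge_atTop k₀.toNat] with k hk
  have hsub : D.cube k (D.index k x) ⊆ D.cube k₀ m :=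
    D.cube_subset_cube (by omega) hxQ (D.mem_cube_index k x)
  refine le_trans (le_of_eq ?_) (D.le_lmaximal (D.cube_mem_cubes k _) hsub w (D.mem_cube_index k x))
  congr 1
  refine setLIntegral_congr_fun (D.measurableSet_cube k _) fun y hy => ?_
  rw [Set.indicator_of_mem (hsub hy)]

end Differentiation

end DyadicLattice

/-! ### Level sets of the maximal function and the reverse Hölder inequality. -/

/-- A geometric sum is at most twice its last term, and that term is below `m`. -/
lemma ENNReal.sum_two_pow_lt_le (m : ℝ≥0∞) :
    ∑' j : ℕ, (if (2 : ℝ≥0∞) ^ j < m then (2 : ℝ≥0∞) ^ j else 0) ≤ 2 * m := by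
  rw [ENNReal.tsum_eq_iSup_nat]
  refine iSup_le fun n => ?_
  have h : ∀ n : ℕ, ∑ j ∈ Finset.range n, (if (2 : ℝ≥0∞) ^ j < m then (2 : ℝ≥0∞) ^ j else 0) ≤ 2 ^ n := by
    intro n
    induction n with
    | zero => simp
    | succ n ih =>
      rw [Finset.sum_range_succ, pow_succ, mul_two]
      refine add_le_add ih ?_
      split_ifs <;> simp
  induction n with
  | zero => simp
  | succ n ih =>
    rw [Finset.sum_range_succ]
    split_ifs with hn
    · rw [two_mul]
      exact add_le_add ((h n).trans hn.le) hn.le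
    · simpa using ih

/-- A sequence dominated by its own tails up to the factor `B` decays geometrically on average. -/
lemma ENNReal.tsum_pow_mul_le_of_tail_le {a : ℕ → ℝ≥0∞} {M B θ : ℝ≥0∞} (hM : M ≠ ∞)
    (hθ : θ ≠ ∞) (ha : ∀ j, a j ≤ M) (hB : ∀ i, ∑' j, a (i + j) ≤ B * a i)
    (h0 : ∑' j, a j ≤ B * M) (hθB : θ * B ≤ 1 / 2) :
    ∑' j, (1 + θ) ^ j * a j ≤ 2 * (B * M) := by
  set U : ℕ → ℝ≥0∞ := fun i => ∑' j, a (i + j) with hU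
  have hUs : ∀ i, U i = a i + U (i + 1) := by
    intro i
    simp only [hU]
    rw [tsum_eq_zero_add' ENNReal.summable]
    simp only [add_zero]
    congr 1
    refine tsum_congr fun j => ?_
    congr 1
    ring
  have hU0 : U 0 ≤ B * M := by simpa [hU] using h0
  set X : ℕ → ℝ≥0∞ := fun n => ∑ j ∈ Finset.range n, (1 + θ) ^ j * a j with hX
  -- Summation by parts. Raising the weight on the tail `U (n + 1)` from `(1+θ)^n` to `(1+θ)^(n+1)`
  -- costs `θ (1+θ)^n U (n + 1)`, which the tail hypothesis bounds by `θ B` times the new term of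
  -- `X`. As `θ B ≤ 1/2`, the total cost is absorbed by the finite `X n`.
  have key : ∀ n, X n + (1 + θ) ^ n * U n ≤ U 0 + θ * B * X n := by
    intro n
    induction n with
    | zero => simp [hX]
    | succ n ih =>
      have h1 : X (n + 1) = X n + (1 + θ) ^ n * a n := by simp [hX, Finset.sum_range_succ]
      have h2 : U (n + 1) ≤ B * a n := (le_add_self.trans (hUs n).ge).trans (hB n)
      calc X (n + 1) + (1 + θ) ^ (n + 1) * U (n + 1)
          = X n + (1 + θ) ^ n * U n + θ * ((1 + θ) ^ n * U (n + 1)) := by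
            rw [h1, hUs n]; ring
        _ ≤ U 0 + θ * B * X n + θ * ((1 + θ) ^ n * (B * a n)) := by gcongr
        _ = U 0 + θ * B * X (n + 1) := by rw [h1]; ring
  rw [ENNReal.tsum_eq_iSup_nat]
  refine iSup_le fun n => ?_
  have hXfin : X n ≠ ∞ := by
    refine ENNReal.sum_ne_top.2 fun j _ => ENNReal.mul_ne_top ?_ (ne_top_of_le_ne_top hM (ha j))
    exact ENNReal.pow_ne_top (by simp [hθ])
  have h1 : X n ≤ B * M + 1 / 2 * X n :=
    le_self_add.trans ((key n).trans (add_le_add hU0 (mul_le_mul_left hθB _)))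
  have h2 : X n = 1 / 2 * X n + 1 / 2 * X n := by
    rw [← add_mul, ENNReal.add_halves, one_mul]
  have h3 : 1 / 2 * X n ≤ B * M := by
    have hfin : 1 / 2 * X n ≠ ∞ := ENNReal.mul_ne_top (by simp) hXfin
    exact (ENNReal.add_le_add_iff_right hfin).1 (h2 ▸ h1)
  calc X n = 2 * (1 / 2 * X n) := by
        rw [← mul_assoc, one_div, ENNReal.mul_inv_cancel (by simp) (by simp), one_mul]
    _ ≤ 2 * (B * M) := by gcongr

namespace DyadicLattice

variable {N : ℕ} (D : DyadicLattice N)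

/-- The superlevel set of the dyadic maximal function. -/
def levelSet (Q : Set (EuclideanSpace ℝ (Fin N))) (w : EuclideanSpace ℝ (Fin N) → ℝ≥0∞)
    (t : ℝ≥0∞) : Set (EuclideanSpace ℝ (Fin N)) :=
  {x | t < D.lmaximal Q w x}

/-- The subcubes of `Q` with average exceeding `t`. -/
def IsLarge (Q : Set (EuclideanSpace ℝ (Fin N))) (w : EuclideanSpace ℝ (Fin N) → ℝ≥0∞)
    (t : ℝ≥0∞) (R : Set (EuclideanSpace ℝ (Fin N))) : Prop :=
  (R ∈ D.cubes ∧ R ⊆ Q) ∧ t < (∫⁻ y in R, w y) / volume R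

variable {D} {Q : Set (EuclideanSpace ℝ (Fin N))} {w : EuclideanSpace ℝ (Fin N) → ℝ≥0∞}
  {s t : ℝ≥0∞}

lemma levelSet_eq_biUnion (hQ : Q ∈ D.cubes) :
    D.levelSet Q w t = ⋃ R ∈ {R | Maximal (D.IsLarge Q w t) R}, R := by
  ext x
  simp only [levelSet, Set.mem_ofPred_eq, lt_lmaximal_iff, Set.mem_iUnion, exists_prop]
  constructor
  · rintro ⟨R, hR, hRQ, hx, ht⟩
    obtain ⟨P, hRP, hP⟩ := D.exists_le_maximal hQ (p := D.IsLarge Q w t) (fun P hP => hP.1)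
      (R := R) ⟨⟨hR, hRQ⟩, ht⟩
    exact ⟨P, hP, hRP hx⟩
  · rintro ⟨R, hR, hx⟩
    exact ⟨R, hR.1.1.1, hR.1.1.2, hx, hR.1.2⟩

lemma countable_maximal_isLarge : {R | Maximal (D.IsLarge Q w t) R}.Countable :=
  D.countable_cubes.mono fun _ hR => hR.1.1.1

lemma measurableSet_levelSet (hQ : Q ∈ D.cubes) : MeasurableSet (D.levelSet Q w t) := by
  rw [levelSet_eq_biUnion hQ]
  exact MeasurableSet.biUnion countable_maximal_isLarge
    fun R hR => D.measurableSet_of_mem hR.1.1.1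

lemma levelSet_subset : D.levelSet Q w t ⊆ Q := by
  intro x hx
  obtain ⟨R, _, hRQ, hxR, _⟩ := (lt_lmaximal_iff D).1 hx
  exact hRQ hxR

lemma levelSet_anti (h : t ≤ s) : D.levelSet Q w s ⊆ D.levelSet Q w t :=
  fun _ hx => lt_of_le_of_lt h hx

/-- The measure is arbitrary because the decomposition into maximal cubes serves both `volume` and
`w dx`. -/
lemma measure_inter_levelSet (hQ : Q ∈ D.cubes) (μ : Measure (EuclideanSpace ℝ (Fin N)))
    {E : Set (EuclideanSpace ℝ (Fin N))} (hE : MeasurableSet E) (hsub : E ⊆ D.levelSet Q w t) :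
    μ E = ∑' R : {R | Maximal (D.IsLarge Q w t) R}, μ (E ∩ R) := by
  have h : E = ⋃ R ∈ {R | Maximal (D.IsLarge Q w t) R}, E ∩ R := by
    rw [← Set.inter_iUnion₂, ← levelSet_eq_biUnion hQ, Set.inter_eq_left.2 hsub]
  conv_lhs => rw [h]
  refine measure_biUnion countable_maximal_isLarge ?_ fun R hR =>
    hE.inter (D.measurableSet_of_mem hR.1.1.1)
  exact (D.pairwiseDisjoint_maximal fun P hP => hP.1.1).mono_on fun R _ => Set.inter_subset_right

lemma measure_levelSet (hQ : Q ∈ D.cubes) (μ : Measure (EuclideanSpace ℝ (Fin N))) :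
    μ (D.levelSet Q w t) = ∑' R : {R | Maximal (D.IsLarge Q w t) R}, μ R := by
  rw [measure_inter_levelSet hQ μ (measurableSet_levelSet hQ) le_rfl]
  refine tsum_congr fun R => ?_
  congr 1
  rw [Set.inter_eq_right, levelSet_eq_biUnion hQ]
  exact Set.subset_biUnion_of_mem (u := fun R => R) R.2

/-- Stopping-time bound: by maximality the dyadic parent has average at most `t`, and it is `2^N`
times larger. That `N ≥ 1` makes the parent differ from `R`. -/
lemma setLIntegral_le_of_maximal (hN : 1 ≤ N) (hQ : Q ∈ D.cubes)
    (ht : (∫⁻ y in Q, w y) / volume Q ≤ t) {R : Set (EuclideanSpace ℝ (Fin N))}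
    (hR : Maximal (D.IsLarge Q w t) R) : ∫⁻ y in R, w y ≤ 2 ^ N * t * volume R := by
  have hRQ : R ⊂ Q := by
    refine hR.1.1.2.ssubset_of_ne ?_
    rintro rfl
    exact absurd hR.1.2 (not_lt.2 ht)
  obtain ⟨P, hP, hRP, hPQ, hvol⟩ := D.exists_parent hR.1.1.1 hQ hRQ
  have hR0 := D.volume_ne_zero hR.1.1.1
  have hRt := D.volume_ne_top hR.1.1.1
  have hPle : (∫⁻ y in P, w y) / volume P ≤ t := by
    by_contra! hlt
    have hPR : P ⊆ R := hR.2 ⟨⟨hP, hPQ⟩, hlt⟩ hRP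
    have hle := measure_mono (μ := volume) hPR
    rw [hvol] at hle
    have h1 : (1 : ℝ≥0∞) < 2 ^ N := one_lt_pow₀ (by norm_num) (by omega)
    have h2 := ENNReal.mul_lt_mul_left hR0 hRt h1
    rw [one_mul] at h2
    exact absurd hle (not_le.2 h2)
  rw [ENNReal.div_le_iff (D.volume_ne_zero hP) (D.volume_ne_top hP), hvol] at hPle
  calc ∫⁻ y in R, w y ≤ ∫⁻ y in P, w y := lintegral_mono_set hRP
    _ ≤ t * (2 ^ N * volume R) := hPle
    _ = 2 ^ N * t * volume R := by ring

lemma setLIntegral_levelSet_le (hN : 1 ≤ N) (hQ : Q ∈ D.cubes)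
    (ht : (∫⁻ y in Q, w y) / volume Q ≤ t) :
    ∫⁻ y in D.levelSet Q w t, w y ≤ 2 ^ N * t * volume (D.levelSet Q w t) := by
  rw [← withDensity_apply _ (measurableSet_levelSet hQ), measure_levelSet hQ, measure_levelSet hQ,
    ← ENNReal.tsum_mul_left]
  refine ENNReal.tsum_le_tsum fun R => ?_
  rw [withDensity_apply _ (D.measurableSet_of_mem R.2.1.1.1)]
  exact setLIntegral_le_of_maximal hN hQ ht R.2

/-- Localisation: a cube witnessing the level `s` that meets `R` lies in `R`. Otherwise it contains
`R` and is itself large at level `t`, so maximality puts it inside `R` after all. -/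
lemma levelSet_inter_subset (hts : t ≤ s) {R : Set (EuclideanSpace ℝ (Fin N))}
    (hR : Maximal (D.IsLarge Q w t) R) : D.levelSet Q w s ∩ R ⊆ D.levelSet R w s := by
  rintro x ⟨hx, hxR⟩
  obtain ⟨P, hP, hPQ, hxP, hlt⟩ := (lt_lmaximal_iff D).1 hx
  refine (lt_lmaximal_iff D).2 ⟨P, hP, ?_, hxP, hlt⟩
  rcases D.subset_or_subset hP hR.1.1.1 hxP hxR with h | h
  · exact h
  · exact hR.2 ⟨⟨hP, hPQ⟩, hts.trans_lt hlt⟩ h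

variable {A : ℝ≥0∞}

/-- This is the integral over `Q` of `ENNReal.sum_two_pow_lt_le` with `m = M_Q w(x)`. -/
lemma tsum_two_pow_mul_volume_levelSet_le (hQ : Q ∈ D.cubes)
    (H : ∫⁻ x in Q, D.lmaximal Q w x ≤ A * ∫⁻ x in Q, w x) :
    ∑' j : ℕ, 2 ^ j * volume (D.levelSet Q w (2 ^ j)) ≤ 2 * A * ∫⁻ x in Q, w x := by
  have h : ∀ j : ℕ, 2 ^ j * volume (D.levelSet Q w (2 ^ j)) =
      ∫⁻ x in Q, (D.levelSet Q w (2 ^ j)).indicator (fun _ => (2 : ℝ≥0∞) ^ j) x := by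
    intro j
    rw [lintegral_indicator_const (measurableSet_levelSet hQ),
      Measure.restrict_apply (measurableSet_levelSet hQ), Set.inter_eq_left.2 levelSet_subset]
  simp_rw [h]
  rw [← lintegral_tsum fun j =>
    (measurable_const.indicator (measurableSet_levelSet hQ)).aemeasurable]
  calc _ ≤ ∫⁻ x in Q, 2 * D.lmaximal Q w x := by
        refine lintegral_mono fun x => ?_
        refine le_trans (le_of_eq ?_) (ENNReal.sum_two_pow_lt_le _)
        simp only [Set.indicator_apply, levelSet, Set.mem_ofPred_eq]
    _ = 2 * ∫⁻ x in Q, D.lmaximal Q w x := lintegral_const_mul' _ _ (by simp)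
    _ ≤ _ := by rw [mul_assoc]; gcongr

/-- Levels above `2^i` localise to the maximal cubes at level `2^i`. The `A_∞` condition is used on
each of these, and their `w`-masses add up to that of the level set. -/
lemma tsum_tail_two_pow_mul_volume_levelSet_le (hQ : Q ∈ D.cubes)
    (H : ∀ R ∈ D.cubes, ∫⁻ x in R, D.lmaximal R w x ≤ A * ∫⁻ x in R, w x) (i : ℕ) :
    ∑' j : ℕ, 2 ^ (i + j) * volume (D.levelSet Q w (2 ^ (i + j))) ≤
      2 * A * ∫⁻ x in D.levelSet Q w (2 ^ i), w x := by
  have hle : ∀ j : ℕ, (2 : ℝ≥0∞) ^ i ≤ 2 ^ (i + j) := fun j =>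
    pow_le_pow_right₀ (by norm_num) (by omega)
  calc _ ≤ ∑' j : ℕ, ∑' R : {R | Maximal (D.IsLarge Q w (2 ^ i)) R},
        2 ^ (i + j) * volume (D.levelSet (R : Set (EuclideanSpace ℝ (Fin N))) w (2 ^ (i + j))) := by
        refine ENNReal.tsum_le_tsum fun j => ?_
        rw [ENNReal.tsum_mul_left, measure_inter_levelSet hQ volume (measurableSet_levelSet hQ)
          (levelSet_anti (hle j))]
        gcongr with R
        exact levelSet_inter_subset (hle j) R.2
    _ = ∑' R : {R | Maximal (D.IsLarge Q w (2 ^ i)) R}, ∑' j : ℕ,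
        2 ^ (i + j) * volume (D.levelSet (R : Set (EuclideanSpace ℝ (Fin N))) w (2 ^ (i + j))) :=
        ENNReal.tsum_comm
    _ ≤ ∑' R : {R | Maximal (D.IsLarge Q w (2 ^ i)) R}, 2 * A *
        (volume.withDensity w) (R : Set (EuclideanSpace ℝ (Fin N))) := by
        refine ENNReal.tsum_le_tsum fun R => ?_
        rw [withDensity_apply _ (D.measurableSet_of_mem R.2.1.1.1)]
        refine le_trans ?_ (tsum_two_pow_mul_volume_levelSet_le R.2.1.1.1 (H R R.2.1.1.1))
        exact ENNReal.tsum_comp_le_tsum_of_injective (add_right_injective i)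
          fun j => 2 ^ j * volume (D.levelSet (R : Set (EuclideanSpace ℝ (Fin N))) w (2 ^ j))
    _ = _ := by
        rw [ENNReal.tsum_mul_left, ← measure_levelSet hQ,
          withDensity_apply _ (measurableSet_levelSet hQ)]

/-- The reverse Hölder inequality for dyadic `A_∞` weights. -/
theorem reverse_holder (hN : 1 ≤ N) (hQ : Q ∈ D.cubes) (hw : AEMeasurable w)
    (hwQ : ∫⁻ x in Q, w x ≤ volume Q)
    (H : ∀ R ∈ D.cubes, ∫⁻ x in R, D.lmaximal R w x ≤ A * ∫⁻ x in R, w x)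
    {ε : ℝ} (hε : 0 < ε) (hε1 : ε ≤ 1) (hεA : ENNReal.ofReal ε * (2 ^ N * (2 * A)) ≤ 1 / 2) :
    ∫⁻ x in Q, w x ^ (1 + ε) ≤ 2 * ∫⁻ x in Q, w x := by
  have hfin : ∫⁻ x in Q, w x ≠ ∞ := ne_top_of_le_ne_top (D.volume_ne_top hQ) hwQ
  have havg : (∫⁻ x in Q, w x) / volume Q ≤ 1 := ENNReal.div_le_of_le_mul (by simpa using hwQ)
  set M := ∫⁻ x in Q, w x with hM
  set B : ℝ≥0∞ := 2 ^ N * (2 * A) with hB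
  set a : ℕ → ℝ≥0∞ := fun j => ∫⁻ x in D.levelSet Q w (2 ^ j), w x with ha
  have hab : ∀ j, a j ≤ 2 ^ N * (2 ^ j * volume (D.levelSet Q w (2 ^ j))) := by
    intro j
    rw [← mul_assoc]
    exact setLIntegral_levelSet_le hN hQ (havg.trans (one_le_pow₀ (by norm_num)))
  have haM : ∀ j, a j ≤ M := fun j => lintegral_mono_set levelSet_subset
  set θ : ℝ≥0∞ := ENNReal.ofReal ((2 : ℝ) ^ ε - 1) with hθ
  -- The ratio `1 + θ` is `2^ε`, and concavity of `s ↦ (1 + s)^ε` gives `θ ≤ ε`.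
  have hρ1 : (1 : ℝ) ≤ (2 : ℝ) ^ ε := Real.one_le_rpow (by norm_num) hε.le
  have hθε : θ ≤ ENNReal.ofReal ε := by
    refine ENNReal.ofReal_le_ofReal ?_
    have := rpow_one_add_le_one_add_mul_self (s := 1) (by norm_num) hε.le hε1
    norm_num at this
    linarith
  have hρ : (2 : ℝ≥0∞) ^ ε = 1 + θ := by
    rw [hθ, ← ENNReal.ofReal_one, ← ENNReal.ofReal_add zero_le_one (by linarith)]
    rw [show (1 : ℝ) + (2 ^ ε - 1) = 2 ^ ε by ring,
      ← ENNReal.ofReal_rpow_of_pos (by norm_num)]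
    simp
  have hθB : θ * B ≤ 1 / 2 := le_trans (mul_le_mul_left hθε _) hεA
  have hX : ∑' j, (1 + θ) ^ j * a j ≤ 2 * (B * M) := by
    -- Here `a j ≤ 2^N · 2^j |E_j|` by the stopping-time bound, while the tails of `∑ 2^j |E_j|`
    -- return at most `2A` times `a i`; hence `B = 2^N · 2A`.
    refine ENNReal.tsum_pow_mul_le_of_tail_le hfin ENNReal.ofReal_ne_top haM (fun i => ?_) ?_ hθB
    · refine (ENNReal.tsum_le_tsum fun j => hab (i + j)).trans ?_
      rw [ENNReal.tsum_mul_left, hB, mul_assoc (2 ^ N)]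
      gcongr
      exact tsum_tail_two_pow_mul_volume_levelSet_le hQ H i
    · refine (ENNReal.tsum_le_tsum hab).trans ?_
      rw [ENNReal.tsum_mul_left, hB, mul_assoc (2 ^ N)]
      gcongr
      exact tsum_two_pow_mul_volume_levelSet_le hQ (H Q hQ)
  -- With `n` least such that `w x ≤ 2^n`, one has `w^ε ≤ (1+θ)^n = 1 + ∑_{j<n} θ(1+θ)^j`; for `j <
  -- n`, `2^j < w x ≤ M_Q w(x)` puts `x` in the level set.
  have hpt : ∀ᵐ x, x ∈ Q → w x ^ (1 + ε) ≤ w x + ∑' j : ℕ,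
      θ * (1 + θ) ^ j * (D.levelSet Q w (2 ^ j)).indicator w x := by
    have hlt : ∀ᵐ x, x ∈ Q → w x < ∞ := by
      rw [← ae_restrict_iff' (D.measurableSet_of_mem hQ)]
      exact ae_lt_top' hw.restrict hfin
    filter_upwards [D.ae_le_lmaximal hQ hw hfin, hlt] with x hx hx' hxQ
    have hex : ∃ n : ℕ, w x ≤ 2 ^ n := by
      obtain ⟨n, hn⟩ := ENNReal.exists_nat_gt (hx' hxQ).ne
      refine ⟨n, hn.le.trans ?_⟩
      exact_mod_cast n.lt_two_pow_self.le
    classical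
    have hmin : ∀ j < Nat.find hex, x ∈ D.levelSet Q w (2 ^ j) := fun j hj =>
      (not_le.1 (Nat.find_min hex hj)).trans_le (hx hxQ)
    have hsum : ∀ n : ℕ, (1 + θ) ^ n = 1 + ∑ j ∈ Finset.range n, θ * (1 + θ) ^ j := by
      intro n
      induction n with
      | zero => simp
      | succ n ih => rw [Finset.sum_range_succ, ← add_assoc, ← ih, pow_succ]; ring
    have hwε : w x ^ ε ≤ (1 + θ) ^ Nat.find hex := by
      calc w x ^ ε ≤ ((2 : ℝ≥0∞) ^ Nat.find hex) ^ ε :=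
            ENNReal.rpow_le_rpow (Nat.find_spec hex) hε.le
        _ = _ := by
            rw [← hρ, ← ENNReal.rpow_natCast, ← ENNReal.rpow_natCast, ← ENNReal.rpow_mul,
              ← ENNReal.rpow_mul, mul_comm]
    rw [ENNReal.rpow_add_of_nonneg 1 ε zero_le_one hε.le, ENNReal.rpow_one]
    calc w x * w x ^ ε ≤ w x * (1 + ∑ j ∈ Finset.range (Nat.find hex), θ * (1 + θ) ^ j) := by
          rw [← hsum]; gcongr
      _ = w x + ∑ j ∈ Finset.range (Nat.find hex),
            θ * (1 + θ) ^ j * (D.levelSet Q w (2 ^ j)).indicator w x := by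
          rw [mul_add, mul_one, Finset.mul_sum]
          congr 1
          refine Finset.sum_congr rfl fun j hj => ?_
          rw [Set.indicator_of_mem (hmin j (Finset.mem_range.1 hj)), mul_comm]
      _ ≤ _ := by gcongr; exact ENNReal.sum_le_tsum _
  have hmeas : ∀ j : ℕ, AEMeasurable (fun x =>
      θ * (1 + θ) ^ j * (D.levelSet Q w (2 ^ j)).indicator w x) (volume.restrict Q) := fun j =>
    ((hw.indicator (measurableSet_levelSet hQ)).const_mul _).restrict
  calc ∫⁻ x in Q, w x ^ (1 + ε) ≤ ∫⁻ x in Q, (w x + ∑' j : ℕ,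
        θ * (1 + θ) ^ j * (D.levelSet Q w (2 ^ j)).indicator w x) :=
        lintegral_mono_ae ((ae_restrict_iff' (D.measurableSet_of_mem hQ)).2 hpt)
    _ = M + ∑' j : ℕ, θ * (1 + θ) ^ j * a j := by
        rw [lintegral_add_left' hw.restrict, lintegral_tsum hmeas]
        congr 1
        refine tsum_congr fun j => ?_
        rw [lintegral_const_mul'' _ (hw.indicator (measurableSet_levelSet hQ)).restrict,
          lintegral_indicator (measurableSet_levelSet hQ),
          Measure.restrict_restrict (measurableSet_levelSet hQ),
          Set.inter_eq_left.2 levelSet_subset]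
    _ ≤ M + θ * (2 * (B * M)) := by
        simp_rw [mul_assoc θ]
        rw [ENNReal.tsum_mul_left]
        gcongr
    _ = M + 2 * (θ * B) * M := by ring
    _ ≤ M + 2 * (1 / 2) * M := by gcongr
    _ = 2 * M := by
        rw [one_div, ENNReal.mul_inv_cancel (by simp) (by simp)]; ring

end DyadicLattice

/-! ### The Carleson embedding theorem. -/

/-- The layer-cake formula, used with exponent `q` for the cube averages and with `q - 1` for the
truncated function; the latter produces the factor `1/(q-1)`. -/
lemma lintegral_Ioi_rpow_indicator {p : ℝ} (hp : 0 < p) {a : ℝ≥0∞} (ha : a ≠ ∞) :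
    ∫⁻ t in Set.Ioi (0 : ℝ), ENNReal.ofReal (t ^ (p - 1)) * (if ENNReal.ofReal t < a then 1 else 0) =
      ENNReal.ofReal p⁻¹ * a ^ p := by
  obtain ⟨r, hr, rfl⟩ : ∃ r : ℝ, 0 ≤ r ∧ a = ENNReal.ofReal r :=
    ⟨a.toReal, ENNReal.toReal_nonneg, (ENNReal.ofReal_toReal ha).symm⟩
  have h1 : ∀ t ∈ Set.Ioi (0 : ℝ), ENNReal.ofReal (t ^ (p - 1)) *
      (if ENNReal.ofReal t < ENNReal.ofReal r then 1 else 0) =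
      (Set.Iio r).indicator (fun t => ENNReal.ofReal (t ^ (p - 1))) t := by
    intro t ht
    rw [Set.indicator_apply]
    by_cases h : t < r
    · simp [h, (ENNReal.ofReal_lt_ofReal_iff (lt_trans ht h)).2 h]
    · simp [h, ENNReal.ofReal_le_ofReal (not_lt.1 h)]
  rw [setLIntegral_congr_fun measurableSet_Ioi h1, lintegral_indicator measurableSet_Iio,
    Measure.restrict_restrict measurableSet_Iio, Set.inter_comm, Set.Ioi_inter_Iio]
  have hint : IntegrableOn (fun t : ℝ => t ^ (p - 1)) (Set.Ioo 0 r) :=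
    ((intervalIntegrable_iff_integrableOn_Ioc_of_le hr).1
      (intervalIntegral.intervalIntegrable_rpow' (by linarith))).mono_set Set.Ioo_subset_Ioc_self
  rw [← ofReal_integral_eq_lintegral_ofReal hint ((ae_restrict_iff' measurableSet_Ioo).2
    (Filter.Eventually.of_forall fun t ht => Real.rpow_nonneg ht.1.le _)),
    ← integral_Ioc_eq_integral_Ioo, ← intervalIntegral.integral_of_le hr,
    integral_rpow (Or.inl (by linarith)), ENNReal.ofReal_rpow_of_nonneg hr hp.le,
    ← ENNReal.ofReal_mul (by positivity)]
  congr 1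
  rw [sub_add_cancel, Real.zero_rpow hp.ne']
  ring

namespace DyadicLattice

variable {N : ℕ} {D : DyadicLattice N} {F : Finset (Set (EuclideanSpace ℝ (Fin N)))} {L : ℝ≥0∞}

open Classical in
-- Weak-type bound with truncation. The Carleson condition reduces the sum to the disjoint maximal
-- cubes; on each of them the part of `g` not exceeding `t/2` carries at most half of the mass
-- `t|P|`, so `|P|` is controlled by the part where `2g > t`.
lemma sum_volume_le_of_carleson (hF : ∀ Q ∈ F, Q ∈ D.cubes)
    (hL : ∀ Q ∈ F, ∑ R ∈ F with R ⊆ Q, volume R ≤ L * volume Q)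
    {g : EuclideanSpace ℝ (Fin N) → ℝ≥0∞} (hg : Measurable g) {t : ℝ≥0∞} (ht0 : t ≠ 0)
    (ht : t ≠ ∞) :
    ∑ Q ∈ F with t < (∫⁻ x in Q, g x) / volume Q, volume Q ≤
      L * (2 / t * ∫⁻ x, if t < 2 * g x then g x else 0) := by
  set G := F.filter fun Q => t < (∫⁻ x in Q, g x) / volume Q with hG
  have hGF : ∀ Q ∈ G, Q ∈ D.cubes := fun Q hQ => hF Q (Finset.mem_filter.1 hQ).1
  set M := G.filter fun P => Maximal (· ∈ G) P with hM
  set h : EuclideanSpace ℝ (Fin N) → ℝ≥0∞ := fun x => if t < 2 * g x then g x else 0 with hh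
  have hhm : Measurable h :=
    Measurable.ite (measurableSet_lt measurable_const (hg.const_mul 2)) hg measurable_const
  have hcover : ∀ Q ∈ G, ∃ P ∈ M, Q ⊆ P := by
    intro Q hQ
    obtain ⟨P, hQP, hP⟩ := G.exists_le_maximal hQ
    exact ⟨P, Finset.mem_filter.2 ⟨hP.1, hP⟩, hQP⟩
  have hvol : ∀ P ∈ G, volume P ≤ 2 / t * ∫⁻ x in P, h x := by
    intro P hP
    have hP0 := D.volume_ne_zero (hGF P hP)
    have hPt := D.volume_ne_top (hGF P hP)
    have h1 : t * volume P < ∫⁻ x in P, g x :=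
      (ENNReal.lt_div_iff_mul_lt (Or.inl hP0) (Or.inl hPt)).1 (Finset.mem_filter.1 hP).2
    have h2 : ∫⁻ x in P, g x ≤ t / 2 * volume P + ∫⁻ x in P, h x := by
      rw [← setLIntegral_const, ← lintegral_add_left measurable_const]
      refine lintegral_mono fun x => ?_
      simp only [hh]
      split_ifs with hx
      · exact le_add_self
      · rw [add_zero, ENNReal.le_div_iff_mul_le (by simp) (by simp), mul_comm]
        exact not_lt.1 hx
    have h3 : t / 2 * volume P + t / 2 * volume P ≤ t / 2 * volume P + ∫⁻ x in P, h x := by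
      rw [← add_mul, ENNReal.add_halves]
      exact h1.le.trans h2
    have h4 : t / 2 * volume P ≤ ∫⁻ x in P, h x :=
      (ENNReal.add_le_add_iff_left (ENNReal.mul_ne_top (ENNReal.div_ne_top ht (by simp)) hPt)).1 h3
    calc volume P = 2 / t * (t / 2 * volume P) := by
          rw [← mul_assoc, ← mul_div_assoc, ENNReal.div_mul_cancel ht0 ht,
            ENNReal.div_self (by simp) (by simp), one_mul]
      _ ≤ _ := by gcongr
  have hdisj : (M : Set (Set (EuclideanSpace ℝ (Fin N)))).PairwiseDisjoint id :=
    (D.pairwiseDisjoint_maximal (p := (· ∈ G)) hGF).subset fun P hP =>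
      (Finset.mem_filter.1 hP).2
  calc ∑ Q ∈ G, volume Q ≤ ∑ Q ∈ G, ∑ P ∈ M, if Q ⊆ P then volume Q else 0 := by
        refine Finset.sum_le_sum fun Q hQ => ?_
        obtain ⟨P, hP, hQP⟩ := hcover Q hQ
        refine le_trans ?_ (Finset.single_le_sum (fun _ _ => zero_le) hP)
        simp [hQP]
    _ = ∑ P ∈ M, ∑ Q ∈ G with Q ⊆ P, volume Q := by
        rw [Finset.sum_comm]
        simp_rw [Finset.sum_filter]
    _ ≤ ∑ P ∈ M, L * (2 / t * ∫⁻ x in P, h x) := by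
        refine Finset.sum_le_sum fun P hP => ?_
        have hPG := (Finset.mem_filter.1 hP).1
        have hPF := (Finset.mem_filter.1 hPG).1
        refine le_trans (Finset.sum_le_sum_of_subset ?_)
          ((hL P hPF).trans (mul_le_mul_right (hvol P hPG) L))
        exact Finset.filter_subset_filter _ (Finset.filter_subset _ _)
    _ = L * (2 / t * ∫⁻ x in ⋃ P ∈ M, P, h x) := by
        rw [lintegral_biUnion_finset (t := fun P => P) hdisj fun P hP =>
          D.measurableSet_of_mem (hGF P (Finset.mem_filter.1 hP).1), Finset.mul_sum, Finset.mul_sum]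
    _ ≤ _ := by
        gcongr
        exact Measure.restrict_le_self

open Classical in
lemma carleson_embedding_of_measurable (hF : ∀ Q ∈ F, Q ∈ D.cubes)
    (hL : ∀ Q ∈ F, ∑ R ∈ F with R ⊆ Q, volume R ≤ L * volume Q)
    {g : EuclideanSpace ℝ (Fin N) → ℝ≥0∞} (hg : Measurable g)
    (hfin : ∀ Q ∈ F, ∫⁻ x in Q, g x ≠ ∞) {q : ℝ} (hq : 1 < q) :
    ∑ Q ∈ F, volume Q * ((∫⁻ x in Q, g x) / volume Q) ^ q ≤
      L * (ENNReal.ofReal (2 ^ q * q / (q - 1)) * ∫⁻ x, g x ^ q) := by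
  have hq0 : 0 < q := by linarith
  have hqq : ENNReal.ofReal q * ENNReal.ofReal q⁻¹ = 1 := by
    rw [← ENNReal.ofReal_mul hq0.le, mul_inv_cancel₀ hq0.ne', ENNReal.ofReal_one]
  set a : Set (EuclideanSpace ℝ (Fin N)) → ℝ≥0∞ := fun Q => (∫⁻ x in Q, g x) / volume Q with ha
  have hafin : ∀ Q ∈ F, a Q ≠ ∞ := fun Q hQ =>
    ENNReal.div_ne_top (hfin Q hQ) (D.volume_ne_zero (hF Q hQ))
  have hmeas1 : ∀ c : ℝ≥0∞, Measurable fun t : ℝ =>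
      ENNReal.ofReal (t ^ (q - 1)) * (if ENNReal.ofReal t < c then 1 else 0) := fun c =>
    (by fun_prop : Measurable fun t : ℝ => ENNReal.ofReal (t ^ (q - 1))).mul
      (Measurable.ite (measurableSet_lt ENNReal.measurable_ofReal measurable_const)
        measurable_const measurable_const)
  -- Marcinkiewicz interpolation: `∫₀^{2g} 2q t^{q-2} g dt = 2q g (2g)^{q-1}/(q-1) = 2^q q/(q-1) ·
  -- g^q`.
  have hpt : ∀ x, ∫⁻ t in Set.Ioi (0 : ℝ), ENNReal.ofReal (2 * q * t ^ (q - 1 - 1)) *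
      (if ENNReal.ofReal t < 2 * g x then g x else 0) ≤
      ENNReal.ofReal (2 ^ q * q / (q - 1)) * g x ^ q := by
    intro x
    by_cases hx : g x = ∞
    · rw [hx, ENNReal.top_rpow_of_pos hq0,
        ENNReal.mul_top (a := ENNReal.ofReal (2 ^ q * q / (q - 1)))]
      · exact le_top
      · have : 0 < q - 1 := by linarith
        exact (ENNReal.ofReal_pos.2 (by positivity)).ne'
    · have h1 : ∀ t : ℝ, ENNReal.ofReal (2 * q * t ^ (q - 1 - 1)) *
          (if ENNReal.ofReal t < 2 * g x then g x else 0) = ENNReal.ofReal (2 * q) * g x *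
          (ENNReal.ofReal (t ^ (q - 1 - 1)) * (if ENNReal.ofReal t < 2 * g x then 1 else 0)) := by
        intro t
        rw [ENNReal.ofReal_mul (by positivity)]
        split_ifs <;> ring
      simp_rw [h1]
      rw [lintegral_const_mul' _ _ (ENNReal.mul_ne_top ENNReal.ofReal_ne_top hx),
        lintegral_Ioi_rpow_indicator (by linarith) (ENNReal.mul_ne_top (by simp) hx),
        ENNReal.mul_rpow_of_nonneg _ _ (by linarith)]
      have h2 : g x * g x ^ (q - 1) = g x ^ q := by
        conv_lhs => rw [← ENNReal.rpow_one (g x), ← ENNReal.rpow_mul, one_mul]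
        rw [← ENNReal.rpow_add_of_nonneg _ _ zero_le_one (by linarith)]
        congr 1; ring
      have h3 : (2 : ℝ≥0∞) ^ (q - 1) = ENNReal.ofReal (2 ^ (q - 1)) := by
        rw [← ENNReal.ofReal_rpow_of_pos (by norm_num)]
        simp
      calc _ = ENNReal.ofReal (2 * q) * ENNReal.ofReal (q - 1)⁻¹ * 2 ^ (q - 1) *
            (g x * g x ^ (q - 1)) := by ring
        _ = _ := by
            rw [h2, h3, ← ENNReal.ofReal_mul (by positivity), ← ENNReal.ofReal_mul
              (mul_nonneg (by positivity) (inv_nonneg.2 (by linarith)))]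
            congr 2
            have h5 : (2 : ℝ) ^ (q - 1) = 2 ^ q / 2 := by
              rw [Real.rpow_sub (by norm_num), Real.rpow_one]
            rw [h5]
            field_simp
        _ ≤ _ := le_rfl
  have hmeas2 : Measurable (Function.uncurry fun (t : ℝ) (x : EuclideanSpace ℝ (Fin N)) =>
      ENNReal.ofReal (2 * q * t ^ (q - 1 - 1)) *
        (if ENNReal.ofReal t < 2 * g x then g x else 0)) := by
    refine Measurable.mul ?_ (Measurable.ite (measurableSet_lt ?_ ?_) ?_ measurable_const)
    · fun_prop
    · fun_prop
    · fun_prop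
    · fun_prop
  calc ∑ Q ∈ F, volume Q * a Q ^ q
      = ∑ Q ∈ F, ∫⁻ t in Set.Ioi (0 : ℝ), volume Q * (ENNReal.ofReal q *
          (ENNReal.ofReal (t ^ (q - 1)) * (if ENNReal.ofReal t < a Q then 1 else 0))) := by
        refine Finset.sum_congr rfl fun Q hQ => ?_
        rw [lintegral_const_mul' _ _ (D.volume_ne_top (hF Q hQ)),
          lintegral_const_mul' _ _ ENNReal.ofReal_ne_top,
          lintegral_Ioi_rpow_indicator hq0 (hafin Q hQ), ← mul_assoc (ENNReal.ofReal q), hqq,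
          one_mul]
    _ = ∫⁻ t in Set.Ioi (0 : ℝ), ∑ Q ∈ F, volume Q * (ENNReal.ofReal q *
          (ENNReal.ofReal (t ^ (q - 1)) * (if ENNReal.ofReal t < a Q then 1 else 0))) := by
        rw [lintegral_finsetSum _ fun Q _ => ((hmeas1 (a Q)).const_mul _).const_mul _]
    _ = ∫⁻ t in Set.Ioi (0 : ℝ), ENNReal.ofReal (q * t ^ (q - 1)) *
          ∑ Q ∈ F with ENNReal.ofReal t < a Q, volume Q := by
        congr 1
        funext t
        rw [Finset.mul_sum, Finset.sum_filter, ENNReal.ofReal_mul hq0.le]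
        refine Finset.sum_congr rfl fun Q _ => ?_
        split_ifs <;> ring
    _ ≤ ∫⁻ t in Set.Ioi (0 : ℝ), L * ∫⁻ x, ENNReal.ofReal (2 * q * t ^ (q - 1 - 1)) *
          (if ENNReal.ofReal t < 2 * g x then g x else 0) := by
        refine setLIntegral_mono' measurableSet_Ioi fun t ht => ?_
        rw [Set.mem_Ioi] at ht
        refine (mul_le_mul_right (sum_volume_le_of_carleson hF hL hg
          (by simpa using ht) ENNReal.ofReal_ne_top) _).trans (le_of_eq ?_)
        rw [lintegral_const_mul' _ _ ENNReal.ofReal_ne_top]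
        have : ENNReal.ofReal (2 * q * t ^ (q - 1 - 1)) =
            ENNReal.ofReal (q * t ^ (q - 1)) * (2 / ENNReal.ofReal t) := by
          rw [show (2 : ℝ≥0∞) = ENNReal.ofReal 2 by simp, ← ENNReal.ofReal_div_of_pos ht,
            ← ENNReal.ofReal_mul (by positivity)]
          congr 1
          rw [Real.rpow_sub_one ht.ne' (q - 1)]
          ring
        rw [this]
        ring
    _ = L * ∫⁻ x, ∫⁻ t in Set.Ioi (0 : ℝ), ENNReal.ofReal (2 * q * t ^ (q - 1 - 1)) *
          (if ENNReal.ofReal t < 2 * g x then g x else 0) := by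
        have hmeas3 : Measurable fun t : ℝ => ∫⁻ x, ENNReal.ofReal (2 * q * t ^ (q - 1 - 1)) *
          (if ENNReal.ofReal t < 2 * g x then g x else 0) := hmeas2.lintegral_prod_right'
        rw [lintegral_const_mul L hmeas3,
          lintegral_lintegral_swap hmeas2.aemeasurable]
    _ ≤ _ := by
        rw [← lintegral_const_mul' _ _ ENNReal.ofReal_ne_top]
        gcongr with x
        exact hpt x

open Classical in
/-- The dyadic Carleson embedding theorem in `L^q`, with the sharp order of growth as `q → 1`. -/
theorem carleson_embedding (hF : ∀ Q ∈ F, Q ∈ D.cubes)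
    (hL : ∀ Q ∈ F, ∑ R ∈ F with R ⊆ Q, volume R ≤ L * volume Q)
    {g : EuclideanSpace ℝ (Fin N) → ℝ≥0∞} (hg : AEMeasurable g)
    (hfin : ∀ Q ∈ F, ∫⁻ x in Q, g x ≠ ∞) {q : ℝ} (hq : 1 < q) :
    ∑ Q ∈ F, volume Q * ((∫⁻ x in Q, g x) / volume Q) ^ q ≤
      L * (ENNReal.ofReal (2 ^ q * q / (q - 1)) * ∫⁻ x, g x ^ q) := by
  have hae := hg.ae_eq_mk
  have h1 : ∀ Q, ∫⁻ x in Q, g x = ∫⁻ x in Q, hg.mk g x := fun Q =>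
    lintegral_congr_ae (ae_restrict_of_ae hae)
  have h2 : ∫⁻ x, g x ^ q = ∫⁻ x, hg.mk g x ^ q :=
    lintegral_congr_ae (hae.fun_comp (· ^ q))
  simp_rw [h1] at hfin ⊢
  rw [h2]
  exact carleson_embedding_of_measurable hF hL hg.measurable_mk hfin hq

end DyadicLattice

/-! ### Sparse and Carleson families. -/

section Sparse

variable {N : ℕ} {D : DyadicLattice N} {S : Set (Set (EuclideanSpace ℝ (Fin N)))}

open Classical in
lemma IsDyadicCarleson.sum_le {lam : ℝ} (hS : IsDyadicCarleson lam S)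
    {F : Finset (Set (EuclideanSpace ℝ (Fin N)))} (hF : (F : Set _) ⊆ S) :
    ∀ Q ∈ F, ∑ R ∈ F with R ⊆ Q, volume R ≤ ENNReal.ofReal lam * volume Q := by
  intro Q hQ
  refine le_trans ?_ (hS Q (hF hQ))
  rw [tsum_subtype {R | R ∈ S ∧ R ⊆ Q} fun R => volume R]
  refine le_trans (Finset.sum_le_sum fun R hR => ?_)
    (ENNReal.sum_le_tsum (F.filter fun R => R ⊆ Q))
  have hR' := Finset.mem_filter.1 hR
  rw [Set.indicator_of_mem (show R ∈ {R | R ∈ S ∧ R ⊆ Q} from ⟨hF hR'.1, hR'.2⟩)]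

open Classical in
-- Induction on the number of generations below `Q`: each cube other than `Q` lies in a child, and
-- the children have total volume at most `κ|Q|`, so the constant is reproduced by `1 + κ/(1-κ) =
-- 1/(1-κ)`.
lemma IsClassicallySparse.sum_le {κ : ℝ} (hκ0 : 0 < κ) (hκ1 : κ < 1) (hSD : S ⊆ D.cubes)
    (hS : IsClassicallySparse κ S) (n : ℕ) :
    ∀ k m, D.cube k m ∈ S → ∀ F : Finset (Set (EuclideanSpace ℝ (Fin N))), (F : Set _) ⊆ S →
      (∀ R ∈ F, R ⊆ D.cube k m ∧ ∃ l m', R = D.cube l m' ∧ l < k + n) →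
      ∑ R ∈ F, volume R ≤ ENNReal.ofReal (1 / (1 - κ)) * volume (D.cube k m) := by
  have h1κ : 0 < 1 - κ := by linarith
  have hone : (1 : ℝ≥0∞) ≤ ENNReal.ofReal (1 / (1 - κ)) := by
    rw [ENNReal.one_le_ofReal, le_div_iff₀ h1κ]
    linarith
  induction n with
  | zero =>
    intro k m hQ F hF hR
    have hsub : F ⊆ {D.cube k m} := by
      intro R hRF
      obtain ⟨hRQ, l, m', rfl, hl⟩ := hR R hRF
      obtain ⟨x, hx⟩ := D.cube_nonempty l m'
      rw [Finset.mem_singleton]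
      exact hRQ.antisymm (D.cube_subset_cube (by simpa using hl.le) hx (hRQ hx))
    calc _ ≤ ∑ R ∈ {D.cube k m}, volume R := Finset.sum_le_sum_of_subset hsub
      _ = 1 * volume (D.cube k m) := by simp
      _ ≤ _ := by gcongr
  | succ n ih =>
    intro k m hQ F hF hR
    set Q := D.cube k m with hQdef
    set G := F.filter fun R => R ≠ Q with hG
    have hGp : ∀ R ∈ G, R ∈ S ∧ R ⊂ Q := fun R hRG =>
      ⟨hF (Finset.mem_filter.1 hRG).1,
        (hR R (Finset.mem_filter.1 hRG).1).1.ssubset_of_ne (Finset.mem_filter.1 hRG).2⟩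
    have hparent : ∀ R ∈ G, ∃ P, R ⊆ P ∧ P ∈ sparseChildren S Q := fun R hRG =>
      D.exists_le_maximal (Q := Q) (p := fun R => R ∈ S ∧ R ⊂ Q) (D.cube_mem_cubes k m)
        (fun P hP => ⟨hSD hP.1, hP.2.1⟩) (hGp R hRG)
    have hchild : ∀ P ∈ sparseChildren S Q, ∑ R ∈ G with R ⊆ P, volume R ≤
        ENNReal.ofReal (1 / (1 - κ)) * volume P := by
      intro P hP
      obtain ⟨j, m₁, rfl⟩ := hSD hP.1.1
      obtain ⟨x, hx⟩ := D.cube_nonempty j m₁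
      -- A child has a strictly larger generation, so one generation fewer remains below it.
      have hkj : k < j := by
        by_contra! h
        exact hP.1.2.2 (D.cube_subset_cube h hx (hP.1.2.1 hx))
      refine ih j m₁ hP.1.1 _ (fun R hRm => (hGp R (Finset.mem_filter.1 hRm).1).1) fun R hRm => ?_
      obtain ⟨hRG, hRP⟩ := Finset.mem_filter.1 hRm
      obtain ⟨-, l, m', hl, hlt⟩ := hR R (Finset.mem_filter.1 hRG).1
      exact ⟨hRP, l, m', hl, by push_cast at hlt; omega⟩
    have hGsum : ∑ R ∈ G, volume R ≤
        ENNReal.ofReal (1 / (1 - κ)) * (ENNReal.ofReal κ * volume Q) := by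
      calc ∑ R ∈ G, volume R
          ≤ ∑ R ∈ G, ∑' P : sparseChildren S Q, if R ⊆ (P : Set (EuclideanSpace ℝ (Fin N))) then volume R else 0 := by
            refine Finset.sum_le_sum fun R hRG => ?_
            obtain ⟨P, hRP, hP⟩ := hparent R hRG
            refine le_trans ?_ (ENNReal.le_tsum ⟨P, hP⟩)
            simp [hRP]
        _ = ∑' P : sparseChildren S Q, ∑ R ∈ G with R ⊆ (P : Set (EuclideanSpace ℝ (Fin N))), volume R := by
            rw [← Summable.tsum_finsetSum fun _ _ => ENNReal.summable]
            simp_rw [Finset.sum_filter]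
        _ ≤ ∑' P : sparseChildren S Q, ENNReal.ofReal (1 / (1 - κ)) * volume (P : Set (EuclideanSpace ℝ (Fin N))) :=
            ENNReal.tsum_le_tsum fun P => hchild P P.2
        _ ≤ _ := by
            rw [ENNReal.tsum_mul_left]
            gcongr
            exact hS Q hQ
    calc ∑ R ∈ F, volume R ≤ volume Q + ∑ R ∈ G, volume R := by
          rw [← Finset.sum_filter_add_sum_filter_not F fun R => R = Q]
          gcongr
          refine (Finset.sum_le_sum_of_subset (t := {Q}) ?_).trans (by simp)
          intro R hRm
          simpa using (Finset.mem_filter.1 hRm).2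
      _ ≤ volume Q + ENNReal.ofReal (1 / (1 - κ)) * (ENNReal.ofReal κ * volume Q) := by gcongr
      _ = ENNReal.ofReal (1 / (1 - κ)) * volume Q := by
          rw [← mul_assoc, ← ENNReal.ofReal_mul (by positivity)]
          conv_lhs => rw [← one_mul (volume Q), ← mul_assoc, mul_one]
          rw [← add_mul, ← ENNReal.ofReal_one, ← ENNReal.ofReal_add zero_le_one (by positivity)]
          congr 2
          field_simp
          ring

/-- A `κ`-sparse family is `1 / (1 - κ)`-Carleson. -/
theorem IsClassicallySparse.isDyadicCarleson {κ : ℝ} (hκ0 : 0 < κ) (hκ1 : κ < 1)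
    (hSD : S ⊆ D.cubes) (hS : IsClassicallySparse κ S) : IsDyadicCarleson (1 / (1 - κ)) S := by
  classical
  intro Q hQ
  rw [ENNReal.tsum_eq_iSup_sum]
  refine iSup_le fun F => ?_
  obtain ⟨k, m, rfl⟩ := hSD hQ
  have hgen : ∀ R : {R | R ∈ S ∧ R ⊆ D.cube k m}, ∃ l : ℤ, ∃ m', (R : Set _) = D.cube l m' :=
    fun R => hSD R.2.1
  choose l m' hl using hgen
  have hlt : ∃ n : ℕ, ∀ R ∈ F, l R < k + n := by
    -- The sum serves as a crude upper bound for the finitely many generations.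
    refine ⟨∑ R ∈ F, (l R - k + 1).toNat, fun R hRF => ?_⟩
    have h1 : (l R - k + 1).toNat ≤ ∑ R ∈ F, (l R - k + 1).toNat :=
      Finset.single_le_sum (f := fun R => (l R - k + 1).toNat) (fun _ _ => Nat.zero_le _) hRF
    omega
  obtain ⟨n, hn⟩ := hlt
  have := hS.sum_le hκ0 hκ1 hSD n k m hQ (F.map (Function.Embedding.subtype _)) ?_ ?_
  · rwa [Finset.sum_map] at this
  · intro R hRF
    obtain ⟨R', _, rfl⟩ := Finset.mem_map.1 (Finset.mem_coe.1 hRF)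
    exact R'.2.1
  · intro R hRF
    obtain ⟨R', hR', rfl⟩ := Finset.mem_map.1 hRF
    exact ⟨R'.2.2, l R', m' R', hl R', hn R' hR'⟩

end Sparse

/-! ### Carleson embedding for square roots of sums of `A_∞` weights. -/

namespace DyadicLattice

variable {N : ℕ} {D : DyadicLattice N} {F : Finset (Set (EuclideanSpace ℝ (Fin N)))} {L A : ℝ≥0∞}

/-- On `Q` the maximal function is at least the average of `w`, so a nonzero mass forces `A ≥ 1`. -/
lemma setLIntegral_eq_zero_of_lt_one {Q : Set (EuclideanSpace ℝ (Fin N))} (hQ : Q ∈ D.cubes)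
    {w : EuclideanSpace ℝ (Fin N) → ℝ≥0∞} (hfin : ∫⁻ x in Q, w x ≠ ∞)
    (H : ∫⁻ x in Q, D.lmaximal Q w x ≤ A * ∫⁻ x in Q, w x) (hA : A < 1) :
    ∫⁻ x in Q, w x = 0 := by
  by_contra h0
  have h1 : ∫⁻ x in Q, w x ≤ ∫⁻ x in Q, D.lmaximal Q w x := by
    calc ∫⁻ x in Q, w x = ∫⁻ _ in Q, (∫⁻ x in Q, w x) / volume Q := by
          rw [setLIntegral_const, ENNReal.div_mul_cancel (D.volume_ne_zero hQ) (D.volume_ne_top hQ)]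
      _ ≤ _ := setLIntegral_mono' (D.measurableSet_of_mem hQ)
          fun x hx => D.le_lmaximal hQ le_rfl w hx
  have h2 := ENNReal.mul_lt_mul_left h0 hfin hA
  rw [one_mul] at h2
  exact absurd (h1.trans H) (not_le.2 h2)

/-- Hölder with exponents `2 + 2ε` and `p` puts `∑ u_i` in `L^{1+ε}`, where reverse Hölder applies
to each summand. Thus the weights disappear and an `L^p` average of `f` with `p < 2` remains. -/
lemma setLIntegral_rpow_half_mul_sq_le {Q : Set (EuclideanSpace ℝ (Fin N))} (hN : 1 ≤ N)
    (hQ : Q ∈ D.cubes) {d : ℕ} {u : Fin d → EuclideanSpace ℝ (Fin N) → ℝ≥0∞}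
    (hu : ∀ i, AEMeasurable (u i)) (huQ : ∀ i, ∫⁻ x in Q, u i x ≤ volume Q)
    (H : ∀ i, ∀ R ∈ D.cubes, ∫⁻ x in R, D.lmaximal R (u i) x ≤ A * ∫⁻ x in R, u i x)
    {f : EuclideanSpace ℝ (Fin N) → ℝ≥0∞} (hf : AEMeasurable f)
    {ε : ℝ} (hε : 0 < ε) (hε1 : ε ≤ 1) (hεA : ENNReal.ofReal ε * (2 ^ N * (2 * A)) ≤ 1 / 2) :
    volume Q * ((∫⁻ x in Q, (∑ i, u i x) ^ (1 / 2 : ℝ) * f x) / volume Q) ^ 2 ≤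
      2 * d * (volume Q * ((∫⁻ x in Q, f x ^ ((2 + 2 * ε) / (1 + 2 * ε))) / volume Q) ^
        ((1 + 2 * ε) / (1 + ε))) := by
  set v := volume Q with hv
  have hv0 : v ≠ 0 := D.volume_ne_zero hQ
  have hvt : v ≠ ∞ := D.volume_ne_top hQ
  set p : ℝ := (2 + 2 * ε) / (1 + 2 * ε) with hp
  set q : ℝ := (1 + 2 * ε) / (1 + ε) with hq
  have hq0 : 0 < q := by positivity
  set Y := ∫⁻ x in Q, f x ^ p with hY
  have hconj : (2 + 2 * ε).HolderConjugate p := by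
    rw [Real.holderConjugate_iff]
    refine ⟨by linarith, ?_⟩
    rw [hp]
    field_simp
    ring
  have hholder : ∫⁻ x in Q, (∑ i, u i x) ^ (1 / 2 : ℝ) * f x ≤
      (∫⁻ x in Q, (∑ i, u i x) ^ (1 + ε)) ^ (1 / (2 + 2 * ε)) * Y ^ (1 / p) := by
    have hm : AEMeasurable (fun x => (∑ i, u i x) ^ (1 / 2 : ℝ)) (volume.restrict Q) :=
      ((Finset.aemeasurable_fun_sum _ fun i _ => hu i).pow_const _).restrict
    refine (ENNReal.lintegral_mul_le_Lp_mul_Lq (volume.restrict Q) hconj hm hf.restrict).trans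
      (le_of_eq ?_)
    congr 3
    funext x
    rw [← ENNReal.rpow_mul]
    congr 1
    ring
  -- Convexity costs `d^ε` and the sum costs `d`. The cruder form `(2d)^(1+ε)` is chosen because the
  -- later power `1/(1+ε)` turns it into exactly `2d`.
  have hrh : ∫⁻ x in Q, (∑ i, u i x) ^ (1 + ε) ≤ (2 * d) ^ (1 + ε) * v := by
    calc ∫⁻ x in Q, (∑ i, u i x) ^ (1 + ε)
        ≤ ∫⁻ x in Q, (d : ℝ≥0∞) ^ ε * ∑ i, u i x ^ (1 + ε) := by
          refine lintegral_mono fun x => ?_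
          refine (ENNReal.rpow_sum_le_const_mul_sum_rpow Finset.univ (fun i => u i x)
            (p := 1 + ε) (by linarith)).trans (le_of_eq ?_)
          simp
      _ = (d : ℝ≥0∞) ^ ε * ∑ i, ∫⁻ x in Q, u i x ^ (1 + ε) := by
          rw [lintegral_const_mul' _ _ (ENNReal.rpow_ne_top_of_nonneg hε.le (by simp)),
            lintegral_finsetSum' _ fun i _ => ((hu i).pow_const _).restrict]
      _ ≤ (d : ℝ≥0∞) ^ ε * ∑ _i : Fin d, 2 * v := by
          gcongr with i
          exact (reverse_holder hN hQ (hu i) (huQ i) (H i) hε hε1 hεA).trans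
            (mul_le_mul_right (huQ i) _)
      _ = 2 * (d : ℝ≥0∞) ^ (1 + ε) * v := by
          rw [Finset.sum_const, Finset.card_univ, Fintype.card_fin, nsmul_eq_mul,
            ENNReal.rpow_add_of_nonneg 1 ε zero_le_one hε.le, ENNReal.rpow_one]
          ring
      _ ≤ (2 * d) ^ (1 + ε) * v := by
          rw [ENNReal.mul_rpow_of_nonneg _ _ (by linarith)]
          gcongr
          calc (2 : ℝ≥0∞) = 2 ^ (1 : ℝ) := (ENNReal.rpow_one _).symm
            _ ≤ 2 ^ (1 + ε) := ENNReal.rpow_le_rpow_of_exponent_le (by norm_num) (by linarith)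
  have hmain : (∫⁻ x in Q, (∑ i, u i x) ^ (1 / 2 : ℝ) * f x) ^ 2 ≤
      2 * d * v ^ (1 / (1 + ε)) * Y ^ q := by
    calc (∫⁻ x in Q, (∑ i, u i x) ^ (1 / 2 : ℝ) * f x) ^ 2
        ≤ (((2 * d) ^ (1 + ε) * v) ^ (1 / (2 + 2 * ε)) * Y ^ (1 / p)) ^ 2 := by
          gcongr
          exact hholder.trans (by gcongr)
      _ = _ := by
          rw [mul_pow, ← ENNReal.rpow_natCast, ← ENNReal.rpow_natCast, ← ENNReal.rpow_mul,
            ← ENNReal.rpow_mul, ENNReal.mul_rpow_of_nonneg _ _ (by positivity), ← ENNReal.rpow_mul]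
          have e1 : (1 + ε) * (1 / (2 + 2 * ε) * ((2 : ℕ) : ℝ)) = 1 := by push_cast; field_simp
          have e2 : 1 / (2 + 2 * ε) * ((2 : ℕ) : ℝ) = 1 / (1 + ε) := by push_cast; field_simp
          have e3 : 1 / p * ((2 : ℕ) : ℝ) = q := by rw [hp, hq]; push_cast; field_simp
          rw [e1, e2, e3, ENNReal.rpow_one]
  have hvpow : v ^ (1 / (1 + ε)) * v ^ q = v ^ 2 := by
    rw [← ENNReal.rpow_add _ _ hv0 hvt, ← ENNReal.rpow_natCast]
    congr 1
    rw [hq]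
    push_cast
    field_simp
    ring
  have hvq0 : v ^ q ≠ 0 := by simp [ENNReal.rpow_eq_zero_iff, hv0, hvt]
  have hvqt : v ^ q ≠ ∞ := ENNReal.rpow_ne_top_of_nonneg hq0.le hvt
  calc v * ((∫⁻ x in Q, (∑ i, u i x) ^ (1 / 2 : ℝ) * f x) / v) ^ 2
      = v * ((∫⁻ x in Q, (∑ i, u i x) ^ (1 / 2 : ℝ) * f x) ^ 2 / v ^ 2) := by
        rw [div_eq_mul_inv, mul_pow, ← ENNReal.inv_pow, ← div_eq_mul_inv]
    _ ≤ v * (2 * d * v ^ (1 / (1 + ε)) * Y ^ q / v ^ 2) := by gcongr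
    _ = 2 * d * (v * (Y / v) ^ q) := by
        rw [ENNReal.div_rpow_of_nonneg _ _ hq0.le]
        have : v ^ (1 / (1 + ε)) / v ^ 2 = (v ^ q)⁻¹ := by
          rw [← hvpow, ENNReal.div_eq_inv_mul]
          rw [ENNReal.mul_inv (Or.inr hvqt) (Or.inr hvq0), mul_right_comm,
            ENNReal.inv_mul_cancel (by simp [ENNReal.rpow_eq_zero_iff, hv0, hvt])
              (ENNReal.rpow_ne_top_of_nonneg (by positivity) hvt), one_mul]
        calc v * (2 * d * v ^ (1 / (1 + ε)) * Y ^ q / v ^ 2)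
            = 2 * d * v * Y ^ q * (v ^ (1 / (1 + ε)) / v ^ 2) := by
              simp only [div_eq_mul_inv]; ring
          _ = _ := by rw [this, div_eq_mul_inv]; ring

open Classical in
/-- A Carleson embedding for averages against square roots of sums of `A_∞` weights, where the
weights may depend on the cube. -/
theorem carleson_embedding_sqrt_sum (hN : 1 ≤ N) (hF : ∀ Q ∈ F, Q ∈ D.cubes)
    (hL : ∀ Q ∈ F, ∑ R ∈ F with R ⊆ Q, volume R ≤ L * volume Q) {d : ℕ}
    {u : Set (EuclideanSpace ℝ (Fin N)) → Fin d → EuclideanSpace ℝ (Fin N) → ℝ≥0∞}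
    (hu : ∀ Q ∈ F, ∀ i, AEMeasurable (u Q i))
    (huQ : ∀ Q ∈ F, ∀ i, ∫⁻ x in Q, u Q i x ≤ volume Q) (hA : A ≠ ∞)
    (H : ∀ Q ∈ F, ∀ i, ∀ R ∈ D.cubes,
      ∫⁻ x in R, D.lmaximal R (u Q i) x ≤ A * ∫⁻ x in R, u Q i x)
    {f : EuclideanSpace ℝ (Fin N) → ℝ≥0∞} (hf : AEMeasurable f) (hf2 : ∫⁻ x, f x ^ 2 ≠ ∞) :
    ∑ Q ∈ F, volume Q * ((∫⁻ x in Q, (∑ i, u Q i x) ^ (1 / 2 : ℝ) * f x) / volume Q) ^ 2 ≤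
      64 * 2 ^ N * d * A * L * ∫⁻ x, f x ^ 2 := by
  -- For `A < 1` all the weights vanish almost everywhere on the cubes of `F`; otherwise `A ≥ 1`
  -- makes `ε ≤ 1/4`.
  rcases lt_or_ge A 1 with hA1 | hA1
  · refine le_of_eq_of_le (Finset.sum_eq_zero fun Q hQ => ?_) zero_le
    have h0 : ∀ i, ∀ᵐ x ∂volume.restrict Q, u Q i x = 0 := fun i =>
      (lintegral_eq_zero_iff' (hu Q hQ i).restrict).1 (setLIntegral_eq_zero_of_lt_one (hF Q hQ)
        (ne_top_of_le_ne_top (D.volume_ne_top (hF Q hQ)) (huQ Q hQ i)) (H Q hQ i Q (hF Q hQ)) hA1)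
    have h1 : ∫⁻ x in Q, (∑ i, u Q i x) ^ (1 / 2 : ℝ) * f x = 0 := by
      rw [← lintegral_zero (μ := volume.restrict Q)]
      refine lintegral_congr_ae ?_
      filter_upwards [ae_all_iff.2 h0] with x hx
      simp [hx]
    rw [h1]
    simp
  · obtain ⟨a, ha0, rfl⟩ : ∃ a : ℝ, 0 ≤ a ∧ A = ENNReal.ofReal a :=
      ⟨A.toReal, ENNReal.toReal_nonneg, (ENNReal.ofReal_toReal hA).symm⟩
    rw [ENNReal.one_le_ofReal] at hA1
    have h2N : (1 : ℝ) ≤ 2 ^ N := one_le_pow₀ (by norm_num)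
    have h2Na : (1 : ℝ) ≤ 2 ^ N * a := one_le_mul_of_one_le_of_one_le h2N hA1
    -- The largest `ε` allowed by `reverse_holder`: `ε · 2^N · 2a = 1/2`.
    set ε : ℝ := 1 / (4 * 2 ^ N * a) with hε
    have hε0 : 0 < ε := by positivity
    have hε4 : ε ≤ 1 / 4 := by
      rw [hε]
      exact one_div_le_one_div_of_le (by norm_num) (by nlinarith)
    have hεA : ENNReal.ofReal ε * (2 ^ N * (2 * ENNReal.ofReal a)) ≤ 1 / 2 := by
      have e1 : (2 : ℝ≥0∞) ^ N * (2 * ENNReal.ofReal a) = ENNReal.ofReal (2 ^ N * (2 * a)) := by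
        rw [ENNReal.ofReal_mul (by positivity), ENNReal.ofReal_mul (by norm_num),
          ENNReal.ofReal_pow (by norm_num)]
        simp
      have e2 : (1 / 2 : ℝ≥0∞) = ENNReal.ofReal (1 / 2) := by
        rw [ENNReal.ofReal_div_of_pos (by norm_num)]
        simp
      rw [e1, e2, ← ENNReal.ofReal_mul hε0.le]
      refine ENNReal.ofReal_le_ofReal (le_of_eq ?_)
      rw [hε]
      field_simp
      norm_num
    set p : ℝ := (2 + 2 * ε) / (1 + 2 * ε) with hp
    set q : ℝ := (1 + 2 * ε) / (1 + ε) with hq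
    have hpq : p * q = 2 := by rw [hp, hq]; field_simp
    have hp0 : 0 < p := by positivity
    have hp2 : p ≤ 2 := by rw [hp, div_le_iff₀ (by positivity)]; linarith
    have hq1 : 1 < q := by rw [hq, lt_div_iff₀ (by positivity)]; linarith
    have hq2 : q ≤ 2 := by rw [hq, div_le_iff₀ (by positivity)]; linarith
    have hfin : ∀ Q ∈ F, ∫⁻ x in Q, f x ^ p ≠ ∞ := by
      intro Q hQ
      have hle : ∫⁻ x in Q, f x ^ p ≤ ∫⁻ x in Q, (1 + f x ^ 2) := by
        refine lintegral_mono fun x => ?_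
        rcases le_total (f x) 1 with h | h
        · exact (ENNReal.rpow_le_one h hp0.le).trans le_self_add
        · refine le_trans ?_ le_add_self
          rw [← ENNReal.rpow_natCast]
          exact ENNReal.rpow_le_rpow_of_exponent_le h (by exact_mod_cast hp2)
      refine ne_top_of_le_ne_top ?_ hle
      rw [lintegral_add_left measurable_const, setLIntegral_const, one_mul]
      exact ENNReal.add_ne_top.2 ⟨D.volume_ne_top (hF Q hQ),
        ne_top_of_le_ne_top hf2 (setLIntegral_le_lintegral _ _)⟩
    -- Since `q/(q-1) = (1+2ε)/ε`, the constant is at most `4 · 2 · (4·2^N a)`. With the factor `2d`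
    -- from Hölder this gives `64·2^N d a`.
    have hconst : 2 ^ q * q / (q - 1) ≤ 32 * 2 ^ N * a := by
      have e1 : q / (q - 1) = (1 + 2 * ε) * (4 * 2 ^ N * a) := by
        have : q - 1 = ε / (1 + ε) := by rw [hq]; field_simp; ring
        rw [this, hq, hε]
        field_simp
      have e2 : (2 : ℝ) ^ q ≤ 4 := by
        calc (2 : ℝ) ^ q ≤ 2 ^ (2 : ℝ) := Real.rpow_le_rpow_of_exponent_le (by norm_num) hq2
          _ = 4 := by norm_num
      rw [mul_div_assoc, e1]
      calc (2 : ℝ) ^ q * ((1 + 2 * ε) * (4 * 2 ^ N * a))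
          ≤ 4 * (2 * (4 * 2 ^ N * a)) := by gcongr; linarith
        _ = _ := by ring
    calc ∑ Q ∈ F, volume Q * ((∫⁻ x in Q, (∑ i, u Q i x) ^ (1 / 2 : ℝ) * f x) / volume Q) ^ 2
        ≤ ∑ Q ∈ F, 2 * d * (volume Q * ((∫⁻ x in Q, f x ^ p) / volume Q) ^ q) :=
          Finset.sum_le_sum fun Q hQ => setLIntegral_rpow_half_mul_sq_le hN (hF Q hQ) (hu Q hQ)
            (huQ Q hQ) (H Q hQ) hf hε0 (by linarith) hεA
      _ = 2 * d * ∑ Q ∈ F, volume Q * ((∫⁻ x in Q, f x ^ p) / volume Q) ^ q := by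
          rw [Finset.mul_sum]
      _ ≤ 2 * d * (L * (ENNReal.ofReal (2 ^ q * q / (q - 1)) * ∫⁻ x, (f x ^ p) ^ q)) := by
          gcongr
          exact carleson_embedding hF hL (hf.pow_const p) hfin hq1
      _ ≤ 2 * d * (L * (ENNReal.ofReal (32 * 2 ^ N * a) * ∫⁻ x, f x ^ 2)) := by
          gcongr with x
          rw [← ENNReal.rpow_mul, hpq]
          simp
      _ = _ := by
          rw [ENNReal.ofReal_mul (by positivity), ENNReal.ofReal_mul (by norm_num),
            ENNReal.ofReal_pow (by norm_num)]
          simp only [ENNReal.ofReal_ofNat]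
          ring

end DyadicLattice

/-! ### Matrix square roots and the factorisation. -/

section MatrixFactor

variable {d : ℕ} {𝕜 : Type} [RCLike 𝕜]

lemma Matrix.l2_opNorm_sq_le_sum (M : Matrix (Fin d) (Fin d) 𝕜) :
    ‖M‖ ^ 2 ≤ ∑ j, ∑ i, ‖M i j‖ ^ 2 := by
  have hnn : 0 ≤ ∑ j, ∑ i, ‖M i j‖ ^ 2 := by positivity
  rw [← Real.sqrt_le_sqrt_iff hnn, Real.sqrt_sq (norm_nonneg _), Matrix.l2_opNorm_def]
  refine ContinuousLinearMap.opNorm_le_bound _ (Real.sqrt_nonneg _) fun x => ?_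
  rw [← Real.sqrt_sq (norm_nonneg x), ← Real.sqrt_mul hnn]
  refine Real.le_sqrt_of_sq_le ?_
  rw [EuclideanSpace.norm_sq_eq, EuclideanSpace.norm_sq_eq, Finset.sum_comm, Finset.sum_mul]
  refine Finset.sum_le_sum fun i _ => ?_
  have h1 : ‖(M *ᵥ WithLp.ofLp x) i‖ ≤ ∑ j, ‖M i j‖ * ‖x j‖ := by
    refine (norm_sum_le Finset.univ fun j => M i j * x j).trans (le_of_eq ?_)
    simp
  calc ‖(M *ᵥ WithLp.ofLp x) i‖ ^ 2 ≤ (∑ j, ‖M i j‖ * ‖x j‖) ^ 2 := by gcongr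
    _ ≤ _ := Finset.sum_mul_sq_le_sq_mul_sq _ _ _

lemma Matrix.posSemidef_sqrt (B : Matrix (Fin d) (Fin d) 𝕜) : (CFC.sqrt B).PosSemidef :=
  Matrix.nonneg_iff_posSemidef.1 (CFC.sqrt_nonneg B)

lemma Matrix.PosSemidef.sqrt_mul_sqrt {B : Matrix (Fin d) (Fin d) 𝕜} (hB : B.PosSemidef) :
    CFC.sqrt B * CFC.sqrt B = B :=
  CFC.sqrt_mul_sqrt_self B (Matrix.nonneg_iff_posSemidef.2 hB)

/-- Columns of `B^{1/2} Z` have squared length `(Bz, z)`; this turns the Frobenius norm of a matrix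
factor into a sum of scalar weights. -/
lemma Matrix.sum_norm_sq_col_eq {B : Matrix (Fin d) (Fin d) 𝕜} (hB : B.PosSemidef)
    (Z : Matrix (Fin d) (Fin d) 𝕜) (j : Fin d) :
    ∑ i, ‖(CFC.sqrt B * Z) i j‖ ^ 2 = RCLike.re (star (Z.col j) ⬝ᵥ (B *ᵥ Z.col j)) := by
  have h1 : star (Z.col j) ⬝ᵥ (B *ᵥ Z.col j) =
      star ((CFC.sqrt B * Z).col j) ⬝ᵥ ((CFC.sqrt B * Z).col j) := by
    have h2 : (CFC.sqrt B * Z).col j = CFC.sqrt B *ᵥ Z.col j := by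
      ext i
      simp [Matrix.mul_apply, Matrix.mulVec, dotProduct]
    rw [h2, Matrix.star_mulVec, (Matrix.posSemidef_sqrt B).1.eq, ← Matrix.dotProduct_mulVec,
      Matrix.mulVec_mulVec, hB.sqrt_mul_sqrt]
  rw [h1, dotProduct, map_sum]
  refine Finset.sum_congr rfl fun i _ => ?_
  simp only [Pi.star_apply, Matrix.col_apply, RCLike.star_def, RCLike.conj_mul]
  norm_cast

lemma Matrix.norm_sqrt_mul_sq_le {B : Matrix (Fin d) (Fin d) 𝕜} (hB : B.PosSemidef)
    (Z : Matrix (Fin d) (Fin d) 𝕜) :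
    ‖CFC.sqrt B * Z‖ ^ 2 ≤ ∑ j, RCLike.re (star (Z.col j) ⬝ᵥ (B *ᵥ Z.col j)) := by
  refine (Matrix.l2_opNorm_sq_le_sum _).trans (le_of_eq ?_)
  exact Finset.sum_congr rfl fun j _ => Matrix.sum_norm_sq_col_eq hB Z j

lemma Matrix.norm_mul_comm_of_isHermitian {B C : Matrix (Fin d) (Fin d) 𝕜} (hB : B.IsHermitian)
    (hC : C.IsHermitian) : ‖B * C‖ = ‖C * B‖ := by
  rw [← Matrix.l2_opNorm_conjTranspose (B * C), Matrix.conjTranspose_mul, hB.eq, hC.eq]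

lemma Matrix.continuousOn_sqrt :
    ContinuousOn (CFC.sqrt : Matrix (Fin d) (Fin d) 𝕜 → Matrix (Fin d) (Fin d) 𝕜) {B | 0 ≤ B} := by
  -- The real normed structure extends the existing `Algebra ℝ` instance, so the continuity obtained
  -- is that of the ambient `CFC.sqrt`.
  let : NormedAlgebra ℝ (Matrix (Fin d) (Fin d) 𝕜) :=
    { (inferInstance : Algebra ℝ (Matrix (Fin d) (Fin d) 𝕜)) with
      norm_smul_le := fun r B => by
        have : r • B = (r : 𝕜) • B := by
          ext i j
          simp [RCLike.real_smul_eq_coe_mul]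
        rw [this]
        refine (norm_smul_le _ _).trans (le_of_eq ?_)
        simp }
  have : IsometricContinuousFunctionalCalculus ℝ (Matrix (Fin d) (Fin d) 𝕜) IsSelfAdjoint := Matrix.instIsometricContinuousFunctionalCalculus
  have : NonUnitalIsometricContinuousFunctionalCalculus ℝ (Matrix (Fin d) (Fin d) 𝕜) IsSelfAdjoint := IsometricContinuousFunctionalCalculus.toNonUnital
  have := CFC.continuousOn_sqrt (A := Matrix (Fin d) (Fin d) 𝕜)
  exact this

lemma Matrix.PosSemidef.add_smul_one_posDef {B : Matrix (Fin d) (Fin d) 𝕜} (hB : B.PosSemidef)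
    {δ : ℝ} (hδ : 0 < δ) : (B + δ • (1 : Matrix (Fin d) (Fin d) 𝕜)).PosDef :=
  Matrix.PosDef.posSemidef_add hB (Matrix.PosDef.one.smul hδ)

/-- For `C = B + δ` and `e` a column of `C^{-1/2}`, `(Ce, e) = 1`, and `B ≤ C`. -/
lemma Matrix.PosSemidef.re_col_inv_sqrt_le {B : Matrix (Fin d) (Fin d) 𝕜} (hB : B.PosSemidef)
    {δ : ℝ} (hδ : 0 < δ) (j : Fin d) :
    RCLike.re (star ((CFC.sqrt (B + δ • (1 : Matrix (Fin d) (Fin d) 𝕜)))⁻¹.col j) ⬝ᵥ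
      (B *ᵥ (CFC.sqrt (B + δ • (1 : Matrix (Fin d) (Fin d) 𝕜)))⁻¹.col j)) ≤ 1 := by
  set C := B + δ • (1 : Matrix (Fin d) (Fin d) 𝕜) with hC
  have hCd : C.PosDef := hB.add_smul_one_posDef hδ
  set e := (CFC.sqrt C)⁻¹.col j with he
  have hunit : IsUnit (CFC.sqrt C).det := by
    have h1 : (CFC.sqrt C).det * (CFC.sqrt C).det = C.det := by
      rw [← Matrix.det_mul, hCd.posSemidef.sqrt_mul_sqrt]
    refine isUnit_iff_ne_zero.2 fun h => hCd.det_pos.ne' ?_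
    rw [← h1, h, zero_mul]
  have h1 : RCLike.re (star e ⬝ᵥ (C *ᵥ e)) = 1 := by
    rw [he, ← Matrix.sum_norm_sq_col_eq hCd.posSemidef, Matrix.mul_nonsing_inv _ hunit]
    rw [Finset.sum_eq_single j]
    · simp
    · intro i _ hij
      simp [Matrix.one_apply_ne hij]
    · simp
  have h2 : RCLike.re (star e ⬝ᵥ (C *ᵥ e)) =
      RCLike.re (star e ⬝ᵥ (B *ᵥ e)) + δ * RCLike.re (star e ⬝ᵥ e) := by
    rw [hC, Matrix.add_mulVec, dotProduct_add, map_add, Matrix.smul_mulVec, Matrix.one_mulVec,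
      dotProduct_smul, RCLike.smul_re]
  have h3 : 0 ≤ RCLike.re (star e ⬝ᵥ e) :=
    (RCLike.nonneg_iff.1 (dotProduct_star_self_nonneg e)).1
  nlinarith [mul_nonneg hδ.le h3]

/-- A substitute for inserting `V^{1/2} V^{-1/2}` and `W^{-1/2} W^{1/2}` that does not need `V` and
`W` to be invertible. -/
theorem Matrix.exists_sqrt_mul_sqrt_factor {V W : Matrix (Fin d) (Fin d) 𝕜} (hV : V.PosSemidef)
    (hW : W.PosSemidef) {η : ℝ} (hη : 0 < η) :
    ∃ (e f : Fin d → Fin d → 𝕜) (m : ℝ), 0 ≤ m ∧ m ^ 2 ≤ ‖CFC.sqrt W * CFC.sqrt V‖ ^ 2 + η ∧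
      (∀ i, RCLike.re (star (e i) ⬝ᵥ (V *ᵥ e i)) ≤ 1) ∧
      (∀ i, RCLike.re (star (f i) ⬝ᵥ (W *ᵥ f i)) ≤ 1) ∧
      ∀ B C : Matrix (Fin d) (Fin d) 𝕜, B.PosSemidef → C.PosSemidef →
        ‖CFC.sqrt B * CFC.sqrt C‖ ≤ m * (√(∑ i, RCLike.re (star (e i) ⬝ᵥ (B *ᵥ e i))) *
          √(∑ i, RCLike.re (star (f i) ⬝ᵥ (C *ᵥ f i)))) := by
  -- Right continuity at `δ = 0` of `B ↦ (B + δ)^{1/2}` allows a `δ > 0` that makes both matrices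
  -- invertible while the middle factor `‖XY‖²` grows by less than `η`.
  have hcont : ∀ {B : Matrix (Fin d) (Fin d) 𝕜}, B.PosSemidef → ContinuousWithinAt
      (fun δ : ℝ => CFC.sqrt (B + δ • (1 : Matrix (Fin d) (Fin d) 𝕜))) (Set.Ici 0) 0 := by
    intro B hB
    have hc : Continuous fun δ : ℝ => B + δ • (1 : Matrix (Fin d) (Fin d) 𝕜) := by fun_prop
    refine ContinuousWithinAt.comp (t := {B | 0 ≤ B}) ?_ hc.continuousWithinAt ?_
    · refine Matrix.continuousOn_sqrt _ ?_
      simpa using Matrix.nonneg_iff_posSemidef.2 hB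
    · intro δ hδ
      exact Matrix.nonneg_iff_posSemidef.2 (hB.add (Matrix.PosSemidef.one.smul hδ))
  have hlim := ((hcont hV).mul (hcont hW)).norm.pow 2
  have hev : ∀ᶠ δ in nhdsWithin (0 : ℝ) (Set.Ici 0),
      ‖CFC.sqrt (V + δ • (1 : Matrix (Fin d) (Fin d) 𝕜)) *
        CFC.sqrt (W + δ • (1 : Matrix (Fin d) (Fin d) 𝕜))‖ ^ 2 <
        ‖CFC.sqrt W * CFC.sqrt V‖ ^ 2 + η := by
    refine hlim.eventually_lt_const ?_
    change ‖CFC.sqrt (V + (0 : ℝ) • (1 : Matrix (Fin d) (Fin d) 𝕜)) *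
        CFC.sqrt (W + (0 : ℝ) • (1 : Matrix (Fin d) (Fin d) 𝕜))‖ ^ 2 < _
    rw [zero_smul, add_zero, add_zero, Matrix.norm_mul_comm_of_isHermitian (Matrix.posSemidef_sqrt V).1
      (Matrix.posSemidef_sqrt W).1]
    linarith
  obtain ⟨δ, hδm, hδ⟩ := ((hev.filter_mono (nhdsWithin_mono 0 Set.Ioi_subset_Ici_self)).and
    self_mem_nhdsWithin).exists
  replace hδ : 0 < δ := hδ
  set X := CFC.sqrt (V + δ • (1 : Matrix (Fin d) (Fin d) 𝕜)) with hX
  set Y := CFC.sqrt (W + δ • (1 : Matrix (Fin d) (Fin d) 𝕜)) with hY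
  have hdet : ∀ {B : Matrix (Fin d) (Fin d) 𝕜}, B.PosSemidef →
      IsUnit (CFC.sqrt (B + δ • (1 : Matrix (Fin d) (Fin d) 𝕜))).det := by
    intro B hB
    have hd := hB.add_smul_one_posDef hδ
    refine isUnit_iff_ne_zero.2 fun h => hd.det_pos.ne' ?_
    rw [← hd.posSemidef.sqrt_mul_sqrt, Matrix.det_mul, h, zero_mul]
  have hXu : IsUnit X.det := hdet hV
  have hYu : IsUnit Y.det := hdet hW
  have hYh : (Y⁻¹).IsHermitian := (Matrix.posSemidef_sqrt _).1.inv
  refine ⟨fun i => X⁻¹.col i, fun i => Y⁻¹.col i, ‖X * Y‖, norm_nonneg _, hδm.le,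
    fun i => hV.re_col_inv_sqrt_le hδ i, fun i => hW.re_col_inv_sqrt_le hδ i, fun B C hB hC => ?_⟩
  have h1 : CFC.sqrt B * CFC.sqrt C = (CFC.sqrt B * X⁻¹) * (X * Y) * (Y⁻¹ * CFC.sqrt C) := by
    have e1 : X⁻¹ * (X * Y) * Y⁻¹ = 1 := by
      rw [← Matrix.mul_assoc, Matrix.nonsing_inv_mul _ hXu, Matrix.one_mul,
        Matrix.mul_nonsing_inv _ hYu]
    calc CFC.sqrt B * CFC.sqrt C = CFC.sqrt B * (X⁻¹ * (X * Y) * Y⁻¹) * CFC.sqrt C := by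
          rw [e1, Matrix.mul_one]
      _ = _ := by simp only [Matrix.mul_assoc]
  have h2 : ‖CFC.sqrt B * X⁻¹‖ ≤
      √(∑ i, RCLike.re (star (X⁻¹.col i) ⬝ᵥ (B *ᵥ X⁻¹.col i))) :=
    Real.le_sqrt_of_sq_le (Matrix.norm_sqrt_mul_sq_le hB _)
  have h3 : ‖Y⁻¹ * CFC.sqrt C‖ ≤
      √(∑ i, RCLike.re (star (Y⁻¹.col i) ⬝ᵥ (C *ᵥ Y⁻¹.col i))) := by
    rw [Matrix.norm_mul_comm_of_isHermitian hYh (Matrix.posSemidef_sqrt C).1]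
    exact Real.le_sqrt_of_sq_le (Matrix.norm_sqrt_mul_sq_le hC _)
  rw [h1]
  calc ‖(CFC.sqrt B * X⁻¹) * (X * Y) * (Y⁻¹ * CFC.sqrt C)‖
      ≤ ‖CFC.sqrt B * X⁻¹‖ * ‖X * Y‖ * ‖Y⁻¹ * CFC.sqrt C‖ :=
        (norm_mul_le _ _).trans (by gcongr; exact norm_mul_le _ _)
    _ = ‖X * Y‖ * (‖CFC.sqrt B * X⁻¹‖ * ‖Y⁻¹ * CFC.sqrt C‖) := by ring
    _ ≤ _ := by gcongr

end MatrixFactor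

/-! ### Passage from real-valued weights to `[0, ∞]`-valued ones. -/

namespace DyadicLattice

variable {N : ℕ} {D : DyadicLattice N}

lemma integrableOn_of_locallyIntegrable {E : Type*} [NormedAddCommGroup E]
    {Q : Set (EuclideanSpace ℝ (Fin N))} (hQ : Q ∈ D.cubes)
    {g : EuclideanSpace ℝ (Fin N) → E} (hg : LocallyIntegrable g volume) : IntegrableOn g Q :=
  (hg.integrableOn_isCompact (D.isBounded_of_mem hQ).isCompact_closure).mono_set subset_closure

lemma ofReal_abs_setAverage {R : Set (EuclideanSpace ℝ (Fin N))} (hR : R ∈ D.cubes)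
    {w : EuclideanSpace ℝ (Fin N) → ℝ} (hw0 : ∀ x, 0 ≤ w x) (hw : LocallyIntegrable w volume) :
    ENNReal.ofReal |⨍ y in R, w y| = (∫⁻ y in R, ENNReal.ofReal (w y)) / volume R := by
  have hpos : 0 < volume.real R :=
    ENNReal.toReal_pos (D.volume_ne_zero hR) (D.volume_ne_top hR)
  rw [abs_of_nonneg (show 0 ≤ ⨍ y in R, w y from integral_nonneg hw0), setAverage_eq, smul_eq_mul, mul_comm, ← div_eq_mul_inv,
    ENNReal.ofReal_div_of_pos hpos, ofReal_integral_eq_lintegral_ofReal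
      (integrableOn_of_locallyIntegrable hR hw) (Filter.Eventually.of_forall hw0),
    ofReal_measureReal (D.volume_ne_top hR)]

lemma maximal_eq_lmaximal (Q : Set (EuclideanSpace ℝ (Fin N)))
    {w : EuclideanSpace ℝ (Fin N) → ℝ} (hw0 : ∀ x, 0 ≤ w x) (hw : LocallyIntegrable w volume)
    (x : EuclideanSpace ℝ (Fin N)) :
    D.maximal Q w x = D.lmaximal Q (fun y => ENNReal.ofReal (w y)) x :=
  iSup_congr fun _ => iSup_congr fun hR => ofReal_abs_setAverage hR.1 hw0 hw

lemma lintegral_lmaximal_le_aInfty {w : EuclideanSpace ℝ (Fin N) → ℝ} (hw0 : ∀ x, 0 ≤ w x)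
    (hw : LocallyIntegrable w volume) {A : ℝ≥0∞} (hA : D.aInfty w ≤ A)
    {R : Set (EuclideanSpace ℝ (Fin N))} (hR : R ∈ D.cubes) :
    ∫⁻ x in R, D.lmaximal R (fun y => ENNReal.ofReal (w y)) x ≤
      A * ∫⁻ x in R, ENNReal.ofReal (w x) := by
  have hR0 := D.volume_ne_zero hR
  have hRt := D.volume_ne_top hR
  have hint : (∫⁻ x in R, ENNReal.ofReal (w x)) ≠ ∞ := by
    have := (integrableOn_of_locallyIntegrable hR hw)
    rw [← ofReal_integral_eq_lintegral_ofReal this (Filter.Eventually.of_forall hw0)]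
    exact ENNReal.ofReal_ne_top
  have key : ∀ C ∈ {C : ℝ≥0∞ | ∀ Q ∈ D.cubes,
      (⨍⁻ x in Q, D.maximal Q w x ∂volume) ≤ C * ENNReal.ofReal (⨍ x in Q, w x)},
      ∫⁻ x in R, D.lmaximal R (fun y => ENNReal.ofReal (w y)) x ≤
      C * ∫⁻ x in R, ENNReal.ofReal (w x) := by
    intro C hC
    have h := hC R hR
    rw [setLAverage_eq, ENNReal.div_le_iff hR0 hRt,
      ← abs_of_nonneg (show 0 ≤ ⨍ x in R, w x from integral_nonneg hw0),
      ofReal_abs_setAverage hR hw0 hw, mul_assoc, ENNReal.div_mul_cancel hR0 hRt] at h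
    simpa only [maximal_eq_lmaximal R hw0 hw] using h
  refine le_trans ?_ (mul_le_mul_left hA _)
  -- When the mass is zero one cannot divide to reach the infimum. Then `C = ⊤` is used: it is
  -- always admissible, since zero mass on a cube kills the maximal function there, and `⊤ * 0 = 0`.
  rcases eq_or_ne (∫⁻ x in R, ENNReal.ofReal (w x)) 0 with h0 | h0
  · have := key ⊤ fun Q hQ => by
      rw [setLAverage_eq, ← abs_of_nonneg (show 0 ≤ ⨍ x in Q, w x from integral_nonneg hw0),
        ofReal_abs_setAverage hQ hw0 hw]
      rcases eq_or_ne (∫⁻ x in Q, ENNReal.ofReal (w x)) 0 with h1 | h1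
      · have hz : ∀ x, D.maximal Q w x = 0 := by
          intro x
          rw [maximal_eq_lmaximal Q hw0 hw, lmaximal]
          simp only [ENNReal.iSup_eq_zero]
          rintro S ⟨_, hSQ, _⟩
          rw [nonpos_iff_eq_zero.1 ((lintegral_mono_set hSQ).trans h1.le), ENNReal.zero_div]
        simp [hz]
      · rw [ENNReal.top_mul (ENNReal.div_ne_zero.2 ⟨h1, D.volume_ne_top hQ⟩)]
        exact le_top
    rw [h0, mul_zero] at this ⊢
    exact this
  · rw [← ENNReal.div_le_iff h0 hint]
    exact le_sInf fun C hC => (ENNReal.div_le_iff h0 hint).2 (key C hC)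

end DyadicLattice

lemma Matrix.isClosed_nonneg {d : ℕ} {𝕜 : Type} [RCLike 𝕜] :
    IsClosed {B : Matrix (Fin d) (Fin d) 𝕜 | 0 ≤ B} := by
  have h : {B : Matrix (Fin d) (Fin d) 𝕜 | 0 ≤ B} =
      {B | Bᴴ = B} ∩ ⋂ e : Fin d → 𝕜, {B | 0 ≤ star e ⬝ᵥ (B *ᵥ e)} := by
    ext B
    simp only [Set.mem_ofPred_eq, Set.mem_inter_iff, Set.mem_iInter, Matrix.nonneg_iff_posSemidef,
      Matrix.posSemidef_iff_dotProduct_mulVec]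
    rfl
  rw [h]
  refine (isClosed_eq (by fun_prop) continuous_id).inter (isClosed_iInter fun e => ?_)
  exact isClosed_le continuous_const (by fun_prop)

/-! ### Scalar weights attached to a matrix weight. -/

section Weights

variable {N d : ℕ} {𝕜 : Type} [RCLike 𝕜] {D : DyadicLattice N}
  {W : EuclideanSpace ℝ (Fin N) → Matrix (Fin d) (Fin d) 𝕜}

namespace IsMatrixWeight

lemma locallyIntegrable_dotProduct (hW : IsMatrixWeight W) (e : Fin d → 𝕜) :
    LocallyIntegrable (fun x => star e ⬝ᵥ (W x *ᵥ e)) volume := by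
  simp only [dotProduct, Matrix.mulVec]
  refine locallyIntegrable_finsetSum _ fun i _ => ?_
  simp_rw [Finset.mul_sum]
  refine locallyIntegrable_finsetSum _ fun j _ => ?_
  have h : (fun x => star e i * (W x i j * e j)) = fun x => (star e i * e j) • W x i j := by
    funext x
    rw [smul_eq_mul]
    ring
  rw [h]
  exact (hW.locallyIntegrable i j).smul (star e i * e j)

lemma locallyIntegrable_scalarWeight (hW : IsMatrixWeight W) (e : Fin d → 𝕜) :
    LocallyIntegrable (scalarWeight W e) volume := fun x =>
  (hW.locallyIntegrable_dotProduct e x).imp fun _ h => ⟨h.1, h.2.re⟩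

lemma scalarWeight_nonneg (hW : IsMatrixWeight W) (e : Fin d → 𝕜) (x) : 0 ≤ scalarWeight W e x :=
  (RCLike.nonneg_iff.1 ((hW.posSemidef x).dotProduct_mulVec_nonneg e)).1

lemma star_dotProduct_matrixAverage (hW : IsMatrixWeight W) {Q : Set (EuclideanSpace ℝ (Fin N))}
    (hQ : Q ∈ D.cubes) (e : Fin d → 𝕜) :
    star e ⬝ᵥ (matrixAverage W Q *ᵥ e) = ⨍ x in Q, star e ⬝ᵥ (W x *ᵥ e) := by
  have hint : ∀ i j, IntegrableOn (fun x => W x i j) Q := fun i j =>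
    DyadicLattice.integrableOn_of_locallyIntegrable hQ (hW.locallyIntegrable i j)
  simp only [dotProduct, Matrix.mulVec, matrixAverage, Matrix.of_apply, setAverage_eq]
  rw [integral_finsetSum _ fun i _ =>
    (integrable_finsetSum _ fun j _ => (hint i j).mul_const (e j)).const_mul _, Finset.smul_sum]
  refine Finset.sum_congr rfl fun i _ => ?_
  rw [integral_const_mul, integral_finsetSum _ fun j _ => (hint i j).mul_const (e j),
    ← mul_smul_comm, Finset.smul_sum]
  congr 1
  refine Finset.sum_congr rfl fun j _ => ?_
  rw [integral_mul_const, smul_mul_assoc]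

lemma posSemidef_matrixAverage (hW : IsMatrixWeight W) {Q : Set (EuclideanSpace ℝ (Fin N))}
    (hQ : Q ∈ D.cubes) : (matrixAverage W Q).PosSemidef := by
  refine Matrix.PosSemidef.of_dotProduct_mulVec_nonneg ?_ fun e => ?_
  · ext i j
    simp only [Matrix.conjTranspose_apply, matrixAverage, Matrix.of_apply, setAverage_eq,
      RCLike.star_def]
    rw [RCLike.real_smul_eq_coe_mul, map_mul, RCLike.conj_ofReal, ← integral_conj,
      ← RCLike.real_smul_eq_coe_mul]
    congr 2
    funext x
    exact (hW.posSemidef x).1.apply i j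
  · rw [hW.star_dotProduct_matrixAverage hQ]
    have h : ∀ x, star e ⬝ᵥ (W x *ᵥ e) = ((scalarWeight W e x : ℝ) : 𝕜) := fun x =>
      (RCLike.conj_eq_iff_re.1 (RCLike.conj_eq_iff_im.2
        (RCLike.nonneg_iff.1 ((hW.posSemidef x).dotProduct_mulVec_nonneg e)).2)).symm
    simp_rw [h]
    rw [setAverage_eq, integral_ofReal, RCLike.real_smul_eq_coe_mul, ← RCLike.ofReal_mul]
    refine RCLike.ofReal_nonneg.2 (mul_nonneg (by positivity) ?_)
    exact integral_nonneg (hW.scalarWeight_nonneg e)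

lemma setAverage_scalarWeight (hW : IsMatrixWeight W) {Q : Set (EuclideanSpace ℝ (Fin N))}
    (hQ : Q ∈ D.cubes) (e : Fin d → 𝕜) :
    ⨍ x in Q, scalarWeight W e x = RCLike.re (star e ⬝ᵥ (matrixAverage W Q *ᵥ e)) := by
  rw [hW.star_dotProduct_matrixAverage hQ, setAverage_eq, setAverage_eq, RCLike.smul_re,
    ← integral_re (DyadicLattice.integrableOn_of_locallyIntegrable hQ
      (hW.locallyIntegrable_dotProduct e)), smul_eq_mul]
  rfl

lemma lintegral_scalarWeight_le (hW : IsMatrixWeight W) {Q : Set (EuclideanSpace ℝ (Fin N))}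
    (hQ : Q ∈ D.cubes) {e : Fin d → 𝕜}
    (he : RCLike.re (star e ⬝ᵥ (matrixAverage W Q *ᵥ e)) ≤ 1) :
    ∫⁻ x in Q, ENNReal.ofReal (scalarWeight W e x) ≤ volume Q := by
  have h := DyadicLattice.ofReal_abs_setAverage hQ (hW.scalarWeight_nonneg e)
    (hW.locallyIntegrable_scalarWeight e)
  rw [abs_of_nonneg (show 0 ≤ ⨍ x in Q, scalarWeight W e x from
    integral_nonneg (hW.scalarWeight_nonneg e)),
    hW.setAverage_scalarWeight hQ] at h
  have h1 : (∫⁻ x in Q, ENNReal.ofReal (scalarWeight W e x)) / volume Q ≤ 1 := by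
    rw [← h]
    simpa using he
  simpa using (ENNReal.div_le_iff (D.volume_ne_zero hQ) (D.volume_ne_top hQ)).1 h1

lemma aemeasurable_scalarWeight (hW : IsMatrixWeight W) (e : Fin d → 𝕜) :
    AEMeasurable fun x => ENNReal.ofReal (scalarWeight W e x) :=
  (hW.locallyIntegrable_scalarWeight e).aestronglyMeasurable.aemeasurable.ennreal_ofReal

lemma lintegral_lmaximal_scalarWeight_le (hW : IsMatrixWeight W) (e : Fin d → 𝕜)
    {R : Set (EuclideanSpace ℝ (Fin N))} (hR : R ∈ D.cubes) :
    ∫⁻ x in R, D.lmaximal R (fun y => ENNReal.ofReal (scalarWeight W e y)) x ≤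
      scalarAInfty D W * ∫⁻ x in R, ENNReal.ofReal (scalarWeight W e x) :=
  DyadicLattice.lintegral_lmaximal_le_aInfty (hW.scalarWeight_nonneg e)
    (hW.locallyIntegrable_scalarWeight e)
    (le_iSup (fun e : Fin d → 𝕜 => D.aInfty (scalarWeight W e)) e) hR

/-- The square root of a matrix weight is almost everywhere measurable. -/
lemma exists_measurable_sqrt (hW : IsMatrixWeight W) :
    ∃ G : EuclideanSpace ℝ (Fin N) → Matrix (Fin d) (Fin d) 𝕜,
      StronglyMeasurable G ∧ (fun x => CFC.sqrt (W x)) =ᵐ[volume] G := by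
  let : MeasurableSpace (Matrix (Fin d) (Fin d) 𝕜) :=
    inferInstanceAs (MeasurableSpace (Fin d → Fin d → 𝕜))
  have : BorelSpace (Matrix (Fin d) (Fin d) 𝕜) :=
    inferInstanceAs (BorelSpace (Fin d → Fin d → 𝕜))
  have : SecondCountableTopology (Matrix (Fin d) (Fin d) 𝕜) :=
    inferInstanceAs (SecondCountableTopology (Fin d → Fin d → 𝕜))
  have hWm : ∀ i j, AEMeasurable (fun x => W x i j) :=
    fun i j => (hW.locallyIntegrable i j).aestronglyMeasurable.aemeasurable
  let W' : EuclideanSpace ℝ (Fin N) → Matrix (Fin d) (Fin d) 𝕜 := fun x i j => (hWm i j).mk _ x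
  have hW'm : Measurable W' :=
    measurable_pi_iff.2 fun i => measurable_pi_iff.2 fun j => (hWm i j).measurable_mk
  -- `CFC.sqrt` is continuous on the closed cone of nonnegative matrices and takes the default value
  -- `0` off it, hence is Borel.
  have hsqrt : Measurable (CFC.sqrt : Matrix (Fin d) (Fin d) 𝕜 → Matrix (Fin d) (Fin d) 𝕜) := by
    classical
    have h := (Matrix.continuousOn_sqrt (𝕜 := 𝕜) (d := d)).measurable_piecewise
      (g := fun _ => 0) continuousOn_const Matrix.isClosed_nonneg.measurableSet
    convert h using 1
    funext B
    by_cases hB : 0 ≤ B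
    · exact (Set.piecewise_eq_of_mem {B | 0 ≤ B} _ _ hB).symm
    · exact (CFC.sqrt_of_not_nonneg hB).trans
        (Set.piecewise_eq_of_notMem {B | 0 ≤ B} CFC.sqrt (fun _ => 0) hB).symm
  refine ⟨fun x => CFC.sqrt (W' x), (hsqrt.comp hW'm).stronglyMeasurable, ?_⟩
  filter_upwards [ae_all_iff.2 fun i => ae_all_iff.2 fun j => (hWm i j).ae_eq_mk] with x hx
  have : W x = W' x := by
    ext i j
    exact hx i j
  rw [this]

end IsMatrixWeight

end Weights

lemma ENNReal.rpow_half_sq (a : ℝ≥0∞) : (a ^ (1 / 2 : ℝ)) ^ 2 = a := by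
  rw [← ENNReal.rpow_two, ← ENNReal.rpow_mul]
  norm_num

lemma ENNReal.le_sq_of_le_mul_sqrt {t k : ℝ≥0∞} (ht : t ≠ ∞) (h : t ≤ k * t ^ (1 / 2 : ℝ)) :
    t ≤ k ^ 2 := by
  rcases eq_or_ne t 0 with rfl | h0
  · exact zero_le
  have hs : t ^ (1 / 2 : ℝ) * t ^ (1 / 2 : ℝ) = t := by
    rw [← ENNReal.rpow_add _ _ h0 ht]
    norm_num
  have hs0 : t ^ (1 / 2 : ℝ) ≠ 0 := by simp [ENNReal.rpow_eq_zero_iff, h0]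
  have hst : t ^ (1 / 2 : ℝ) ≠ ∞ := ENNReal.rpow_ne_top_of_nonneg (by norm_num) ht
  have h1 : t ^ (1 / 2 : ℝ) ≤ k := by
    refine (ENNReal.mul_le_mul_iff_left hs0 hst).1 ?_
    rwa [hs]
  calc t = t ^ (1 / 2 : ℝ) * t ^ (1 / 2 : ℝ) := hs.symm
    _ ≤ k * k := by gcongr
    _ = k ^ 2 := (sq k).symm

/-! ### The `L²` bound for the Lerner operator. -/

section Operator

variable {N d : ℕ} {𝕜 : Type} [RCLike 𝕜] {D : DyadicLattice N}
  {V W : EuclideanSpace ℝ (Fin N) → Matrix (Fin d) (Fin d) 𝕜}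

lemma aemeasurable_setLAverage_norm_sqrt_mul_sqrt (hV : IsMatrixWeight V) (hW : IsMatrixWeight W)
    {f : EuclideanSpace ℝ (Fin N) → ℝ} (hf : AEMeasurable f)
    (Q : Set (EuclideanSpace ℝ (Fin N))) :
    AEMeasurable fun x => ⨍⁻ y in Q,
      ENNReal.ofReal (‖CFC.sqrt (V x) * CFC.sqrt (W y)‖ * |f y|) ∂volume := by
  obtain ⟨G, hG, hVG⟩ := hV.exists_measurable_sqrt
  obtain ⟨H, hH, hWH⟩ := hW.exists_measurable_sqrt
  have hm : Measurable fun p : EuclideanSpace ℝ (Fin N) × EuclideanSpace ℝ (Fin N) =>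
      ENNReal.ofReal (‖G p.1 * H p.2‖ * |hf.mk f p.2|) := by
    have h1 : StronglyMeasurable fun p : EuclideanSpace ℝ (Fin N) × EuclideanSpace ℝ (Fin N) =>
        G p.1 * H p.2 :=
      (hG.comp_measurable measurable_fst).mul (hH.comp_measurable measurable_snd)
    have h2 : Measurable fun p : EuclideanSpace ℝ (Fin N) × EuclideanSpace ℝ (Fin N) =>
        |hf.mk f p.2| := (hf.measurable_mk.comp measurable_snd).abs
    exact (h1.norm.measurable.mul h2).ennreal_ofReal
  have hmeas : Measurable fun x => ∫⁻ y in Q, ENNReal.ofReal (‖G x * H y‖ * |hf.mk f y|) :=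
    hm.lintegral_prod_right'
  refine ⟨fun x => (∫⁻ y in Q, ENNReal.ofReal (‖G x * H y‖ * |hf.mk f y|)) / volume Q,
    hmeas.div_const _, ?_⟩
  filter_upwards [hVG] with x hx
  rw [setLAverage_eq]
  congr 1
  refine lintegral_congr_ae (ae_restrict_of_ae ?_)
  filter_upwards [hWH, hf.ae_eq_mk] with y hy hfy
  rw [hx, hy, hfy]

open Classical in
lemma lintegral_sq_sum_le (hN : 1 ≤ N) (hV : IsMatrixWeight V) (hW : IsMatrixWeight W)
    (hAV : scalarAInfty D V ≠ ∞) (hAW : scalarAInfty D W ≠ ∞) (hJ : jointA2 D W V ≠ ∞)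
    {F : Finset (Set (EuclideanSpace ℝ (Fin N)))} {L : ℝ≥0∞} (hLt : L ≠ ∞)
    (hF : ∀ Q ∈ F, Q ∈ D.cubes)
    (hL : ∀ Q ∈ F, ∑ R ∈ F with R ⊆ Q, volume R ≤ L * volume Q)
    {f : EuclideanSpace ℝ (Fin N) → ℝ} (hf : AEMeasurable f) (hf2 : ∫⁻ x, ‖f x‖ₑ ^ 2 ≠ ∞)
    {η : ℝ} (hη : 0 < η) :
    ∫⁻ x, (∑ Q ∈ F, Q.indicator (fun x => ⨍⁻ y in Q,
      ENNReal.ofReal (‖CFC.sqrt (V x) * CFC.sqrt (W y)‖ * |f y|) ∂volume) x) ^ 2 ≤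
      (jointA2 D W V + ENNReal.ofReal η) * (64 * 2 ^ N * d * L) ^ 2 *
        scalarAInfty D W * scalarAInfty D V * ∫⁻ x, ‖f x‖ₑ ^ 2 := by
  -- The condition `Q ∈ D.cubes` sits inside the existential so that `choose` yields functions of
  -- all `Q`.
  have hfac : ∀ Q : Set (EuclideanSpace ℝ (Fin N)), ∃ (e g : Fin d → Fin d → 𝕜) (m : ℝ),
      Q ∈ D.cubes → 0 ≤ m ∧ ENNReal.ofReal (m ^ 2) ≤ jointA2 D W V + ENNReal.ofReal η ∧
      (∀ i, RCLike.re (star (e i) ⬝ᵥ (matrixAverage V Q *ᵥ e i)) ≤ 1) ∧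
      (∀ i, RCLike.re (star (g i) ⬝ᵥ (matrixAverage W Q *ᵥ g i)) ≤ 1) ∧
      ∀ B C : Matrix (Fin d) (Fin d) 𝕜, B.PosSemidef → C.PosSemidef →
        ‖CFC.sqrt B * CFC.sqrt C‖ ≤ m * (√(∑ i, RCLike.re (star (e i) ⬝ᵥ (B *ᵥ e i))) *
          √(∑ i, RCLike.re (star (g i) ⬝ᵥ (C *ᵥ g i)))) := by
    intro Q
    by_cases hQ : Q ∈ D.cubes
    · obtain ⟨e, g, m, hm0, hm, he, hg, h⟩ := Matrix.exists_sqrt_mul_sqrt_factor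
        (hV.posSemidef_matrixAverage hQ) (hW.posSemidef_matrixAverage hQ) hη
      refine ⟨e, g, m, fun _ => ⟨hm0, ?_, he, hg, h⟩⟩
      refine (ENNReal.ofReal_le_ofReal hm).trans ?_
      rw [ENNReal.ofReal_add (by positivity) hη.le]
      gcongr
      exact le_iSup₂ (f := fun Q _ => ENNReal.ofReal
        (‖CFC.sqrt (matrixAverage W Q) * CFC.sqrt (matrixAverage V Q)‖ ^ 2)) Q hQ
    · exact ⟨0, 0, 0, fun h => absurd h hQ⟩
  choose e g m hfac using hfac
  set K : ℝ≥0∞ := jointA2 D W V + ENNReal.ofReal η with hK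
  have hKt : K ≠ ∞ := ENNReal.add_ne_top.2 ⟨hJ, ENNReal.ofReal_ne_top⟩
  set v : Set (EuclideanSpace ℝ (Fin N)) → Fin d → EuclideanSpace ℝ (Fin N) → ℝ≥0∞ :=
    fun Q i x => ENNReal.ofReal (scalarWeight V (e Q i) x) with hv
  set w : Set (EuclideanSpace ℝ (Fin N)) → Fin d → EuclideanSpace ℝ (Fin N) → ℝ≥0∞ :=
    fun Q i x => ENNReal.ofReal (scalarWeight W (g Q i) x) with hw
  set φ2 := ∫⁻ x, ‖f x‖ₑ ^ 2 with hφ2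
  set c : Set (EuclideanSpace ℝ (Fin N)) → ℝ≥0∞ := fun Q =>
    (∫⁻ x in Q, (∑ i, w Q i x) ^ (1 / 2 : ℝ) * ‖f x‖ₑ) / volume Q with hc
  set r : Set (EuclideanSpace ℝ (Fin N)) → EuclideanSpace ℝ (Fin N) → ℝ≥0∞ :=
    fun Q x => (∑ i, v Q i x) ^ (1 / 2 : ℝ) with hr
  set T : EuclideanSpace ℝ (Fin N) → ℝ≥0∞ := fun x =>
    ∑ Q ∈ F, Q.indicator (fun x => K ^ (1 / 2 : ℝ) * c Q * r Q x) x with hT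
  have hvm : ∀ Q i, AEMeasurable (v Q i) := fun Q i => hV.aemeasurable_scalarWeight _
  have hwm : ∀ Q i, AEMeasurable (w Q i) := fun Q i => hW.aemeasurable_scalarWeight _
  have hrm : ∀ Q, AEMeasurable (r Q) := fun Q =>
    (Finset.aemeasurable_fun_sum _ fun i _ => hvm Q i).pow_const _
  have hTm : AEMeasurable T := Finset.aemeasurable_fun_sum _ fun Q hQ =>
    ((hrm Q).const_mul _).indicator (D.measurableSet_of_mem (hF Q hQ))
  have hvQ : ∀ Q ∈ F, ∀ i, ∫⁻ x in Q, v Q i x ≤ volume Q := fun Q hQ i =>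
    hV.lintegral_scalarWeight_le (hF Q hQ) ((hfac Q (hF Q hQ)).2.2.1 i)
  have hwQ : ∀ Q ∈ F, ∀ i, ∫⁻ x in Q, w Q i x ≤ volume Q := fun Q hQ i =>
    hW.lintegral_scalarWeight_le (hF Q hQ) ((hfac Q (hF Q hQ)).2.2.2.1 i)
  -- the pointwise bound by `T`
  have hpt : ∀ x, ∑ Q ∈ F, Q.indicator (fun x => ⨍⁻ y in Q,
      ENNReal.ofReal (‖CFC.sqrt (V x) * CFC.sqrt (W y)‖ * |f y|) ∂volume) x ≤ T x := by
    intro x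
    refine Finset.sum_le_sum fun Q hQ => Set.indicator_le_indicator ?_
    obtain ⟨hm0, hm2, -, -, hbd⟩ := hfac Q (hF Q hQ)
    have hmK : ENNReal.ofReal (m Q) ≤ K ^ (1 / 2 : ℝ) := by
      rw [one_div, ENNReal.le_rpow_inv_iff (by norm_num), ENNReal.rpow_two,
        ← ENNReal.ofReal_pow hm0]
      exact hm2
    have hsqrt : ∀ {U : EuclideanSpace ℝ (Fin N) → Matrix (Fin d) (Fin d) 𝕜}, IsMatrixWeight U →
        ∀ (h : Fin d → Fin d → 𝕜) (y), ENNReal.ofReal (√(∑ i, RCLike.re (star (h i) ⬝ᵥ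
          (U y *ᵥ h i)))) = (∑ i, ENNReal.ofReal (scalarWeight U (h i) y)) ^ (1 / 2 : ℝ) := by
      intro U hU h y
      have h0 : ∀ i, 0 ≤ scalarWeight U (h i) y := fun i => hU.scalarWeight_nonneg _ _
      rw [← ENNReal.ofReal_sum_of_nonneg fun i _ => h0 i,
        ENNReal.ofReal_rpow_of_nonneg (Finset.sum_nonneg fun i _ => h0 i) (by norm_num),
        Real.sqrt_eq_rpow]
      rfl
    rw [setLAverage_eq]
    calc (∫⁻ y in Q, ENNReal.ofReal (‖CFC.sqrt (V x) * CFC.sqrt (W y)‖ * |f y|)) / volume Q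
        ≤ (∫⁻ y in Q, K ^ (1 / 2 : ℝ) * r Q x *
            ((∑ i, w Q i y) ^ (1 / 2 : ℝ) * ‖f y‖ₑ)) / volume Q := by
          gcongr with y
          have h1 := hbd (V x) (W y) (hV.posSemidef x) (hW.posSemidef y)
          rw [ENNReal.ofReal_mul (norm_nonneg _), ← Real.norm_eq_abs, ofReal_norm (f y), ← mul_assoc]
          gcongr
          refine (ENNReal.ofReal_le_ofReal h1).trans ?_
          rw [ENNReal.ofReal_mul hm0, ENNReal.ofReal_mul (Real.sqrt_nonneg _), hsqrt hV, hsqrt hW,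
            ← mul_assoc]
          gcongr
      _ ≤ (K ^ (1 / 2 : ℝ) * r Q x * ∫⁻ y in Q,
            ((∑ i, w Q i y) ^ (1 / 2 : ℝ) * ‖f y‖ₑ)) / volume Q := by
          rw [lintegral_const_mul'']
          exact (((Finset.aemeasurable_fun_sum _ fun i _ => hwm Q i).pow_const _).mul
            hf.enorm).restrict
      _ = K ^ (1 / 2 : ℝ) * c Q * r Q x := by
          simp only [hc, div_eq_mul_inv]
          ring
  -- the two Carleson embeddings
  have hembW : ∑ Q ∈ F, volume Q * c Q ^ 2 ≤ 64 * 2 ^ N * d * scalarAInfty D W * L * φ2 :=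
    DyadicLattice.carleson_embedding_sqrt_sum hN hF hL (fun Q _ i => hwm Q i) hwQ hAW
      (fun Q _ i R hR => hW.lintegral_lmaximal_scalarWeight_le _ hR) hf.enorm hf2
  have hct : ∀ Q ∈ F, c Q ≠ ∞ := by
    intro Q hQ hcQ
    have h1 : volume Q * c Q ^ 2 ≤ 64 * 2 ^ N * d * scalarAInfty D W * L * φ2 :=
      (Finset.single_le_sum (f := fun Q => volume Q * c Q ^ 2) (fun _ _ => zero_le) hQ).trans hembW
    rw [hcQ, ENNReal.top_pow (by norm_num), ENNReal.mul_top (D.volume_ne_zero (hF Q hQ)),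
      top_le_iff] at h1
    refine absurd h1 ?_
    finiteness
  -- Finiteness is what permits the final cancellation of `(∫ T²)^{1/2}`. It holds because `F` is
  -- finite, each `c Q` is finite by the first embedding, and `r Q ^ 2` is integrable on `Q`.
  have hTt : ∫⁻ x, T x ^ 2 ≠ ∞ := by
    have hle : ∫⁻ x, T x ^ 2 ≤ ∫⁻ x, (F.card : ℝ≥0∞) * ∑ Q ∈ F,
        Q.indicator (fun x => (K ^ (1 / 2 : ℝ) * c Q) ^ 2 * ∑ i, v Q i x) x := by
      refine lintegral_mono fun x => ?_
      have h1 := ENNReal.rpow_sum_le_const_mul_sum_rpow F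
        (fun Q => Q.indicator (fun x => K ^ (1 / 2 : ℝ) * c Q * r Q x) x) (p := 2) (by norm_num)
      rw [show (2 : ℝ) - 1 = 1 by norm_num, ENNReal.rpow_one, ENNReal.rpow_two] at h1
      refine h1.trans (le_of_eq ?_)
      congr 1
      refine Finset.sum_congr rfl fun Q _ => ?_
      by_cases hx : x ∈ Q
      · simp only [Set.indicator_of_mem hx, hr]
        rw [ENNReal.rpow_two, mul_pow _ ((∑ i, v Q i x) ^ (1 / 2 : ℝ)), ← ENNReal.rpow_two
          ((∑ i, v Q i x) ^ (1 / 2 : ℝ)), ← ENNReal.rpow_mul]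
        norm_num
      · simp [Set.indicator_of_notMem hx]
    refine ne_top_of_le_ne_top ?_ hle
    rw [lintegral_const_mul' _ _ (by simp), lintegral_finsetSum' _ fun Q hQ =>
      ((Finset.aemeasurable_fun_sum _ fun i _ => hvm Q i).const_mul _).indicator
        (D.measurableSet_of_mem (hF Q hQ))]
    refine ENNReal.mul_ne_top (by simp) (ENNReal.sum_ne_top.2 fun Q hQ => ?_)
    have hKc : (K ^ (1 / 2 : ℝ) * c Q) ^ 2 ≠ ∞ := ENNReal.pow_ne_top
      (ENNReal.mul_ne_top (ENNReal.rpow_ne_top_of_nonneg (by norm_num) hKt) (hct Q hQ))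
    rw [lintegral_indicator (D.measurableSet_of_mem (hF Q hQ)), lintegral_const_mul' _ _ hKc,
      lintegral_finsetSum' _ fun i _ => (hvm Q i).restrict]
    exact ENNReal.mul_ne_top hKc (ENNReal.sum_ne_top.2 fun i _ =>
      ne_top_of_le_ne_top (D.volume_ne_top (hF Q hQ)) (hvQ Q hQ i))
  set b : Set (EuclideanSpace ℝ (Fin N)) → ℝ≥0∞ := fun Q =>
    (∫⁻ x in Q, r Q x * T x) / volume Q with hb
  have hembV : ∑ Q ∈ F, volume Q * b Q ^ 2 ≤
      64 * 2 ^ N * d * scalarAInfty D V * L * ∫⁻ x, T x ^ 2 :=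
    DyadicLattice.carleson_embedding_sqrt_sum hN hF hL (fun Q _ i => hvm Q i) hvQ hAV
      (fun Q _ i R hR => hV.lintegral_lmaximal_scalarWeight_le _ hR) hTm hTt
  have hrT : ∀ Q, AEMeasurable fun x => r Q x * T x := fun Q => (hrm Q).mul hTm
  -- One factor of `T²` is expanded as its defining sum and the other is kept, so `T` itself becomes
  -- the function in the second embedding.
  have hdual : ∫⁻ x, T x ^ 2 = K ^ (1 / 2 : ℝ) * ∑ Q ∈ F, volume Q * (c Q * b Q) := by
    have h1 : ∀ x, T x ^ 2 = ∑ Q ∈ F,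
        Q.indicator (fun x => K ^ (1 / 2 : ℝ) * c Q * (r Q x * T x)) x := by
      intro x
      rw [sq]
      conv_lhs => enter [1]; rw [hT]
      rw [Finset.sum_mul]
      refine Finset.sum_congr rfl fun Q _ => ?_
      by_cases hx : x ∈ Q
      · simp only [Set.indicator_of_mem hx]
        ring
      · simp [Set.indicator_of_notMem hx]
    simp_rw [h1]
    rw [lintegral_finsetSum' _ fun Q hQ => ((hrT Q).const_mul _).indicator
      (D.measurableSet_of_mem (hF Q hQ)), Finset.mul_sum]
    refine Finset.sum_congr rfl fun Q hQ => ?_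
    rw [lintegral_indicator (D.measurableSet_of_mem (hF Q hQ)),
      lintegral_const_mul'' _ (hrT Q).restrict]
    have h2 : volume Q * b Q = ∫⁻ x in Q, r Q x * T x :=
      ENNReal.mul_div_cancel (D.volume_ne_zero (hF Q hQ)) (D.volume_ne_top (hF Q hQ))
    rw [← h2]
    ring
  have hcs : ∑ Q ∈ F, volume Q * (c Q * b Q) ≤
      (∑ Q ∈ F, volume Q * c Q ^ 2) ^ (1 / 2 : ℝ) * (∑ Q ∈ F, volume Q * b Q ^ 2) ^ (1 / 2 : ℝ) := by
    have h1 := ENNReal.inner_le_Lp_mul_Lq F (fun Q => volume Q ^ (1 / 2 : ℝ) * c Q)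
      (fun Q => volume Q ^ (1 / 2 : ℝ) * b Q) Real.HolderConjugate.two_two
    simp only [ENNReal.rpow_two, mul_pow, ENNReal.rpow_half_sq] at h1
    refine le_trans (le_of_eq (Finset.sum_congr rfl fun Q _ => ?_)) h1
    conv_lhs => rw [← ENNReal.rpow_half_sq (volume Q)]
    ring
  refine (lintegral_mono fun x => pow_le_pow_left' (hpt x) 2).trans ?_
  have hmain : ∫⁻ x, T x ^ 2 ≤ K ^ (1 / 2 : ℝ) *
      (64 * 2 ^ N * d * scalarAInfty D W * L * φ2) ^ (1 / 2 : ℝ) *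
      (64 * 2 ^ N * d * scalarAInfty D V * L) ^ (1 / 2 : ℝ) * (∫⁻ x, T x ^ 2) ^ (1 / 2 : ℝ) := by
    calc ∫⁻ x, T x ^ 2 = K ^ (1 / 2 : ℝ) * ∑ Q ∈ F, volume Q * (c Q * b Q) := hdual
      _ ≤ K ^ (1 / 2 : ℝ) * ((64 * 2 ^ N * d * scalarAInfty D W * L * φ2) ^ (1 / 2 : ℝ) *
          (64 * 2 ^ N * d * scalarAInfty D V * L * ∫⁻ x, T x ^ 2) ^ (1 / 2 : ℝ)) := by
          gcongr
          exact hcs.trans (by gcongr)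
      _ = _ := by
          rw [ENNReal.mul_rpow_of_nonneg _ (∫⁻ x, T x ^ 2) (by norm_num)]
          ring
  refine (ENNReal.le_sq_of_le_mul_sqrt hTt hmain).trans (le_of_eq ?_)
  rw [mul_pow, mul_pow, ENNReal.rpow_half_sq, ENNReal.rpow_half_sq, ENNReal.rpow_half_sq]
  ring

variable {S : Set (Set (EuclideanSpace ℝ (Fin N)))}

lemma lintegral_scalarLerner_sq_le (hN : 1 ≤ N) (hV : IsMatrixWeight V) (hW : IsMatrixWeight W)
    (hAV : scalarAInfty D V ≠ ∞) (hAW : scalarAInfty D W ≠ ∞) (hJ : jointA2 D W V ≠ ∞)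
    (hSD : S ⊆ D.cubes) {lam : ℝ} (hS : IsDyadicCarleson lam S)
    {f : EuclideanSpace ℝ (Fin N) → ℝ} (hf : AEMeasurable f) (hf2 : ∫⁻ x, ‖f x‖ₑ ^ 2 ≠ ∞) :
    ∫⁻ x, scalarLerner S V W f x ^ 2 ≤
      jointA2 D W V * (64 * 2 ^ N * d * ENNReal.ofReal lam) ^ 2 *
        scalarAInfty D W * scalarAInfty D V * ∫⁻ x, ‖f x‖ₑ ^ 2 := by
  classical
  set C : ℝ≥0∞ := (64 * 2 ^ N * d * ENNReal.ofReal lam) ^ 2 * scalarAInfty D W *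
    scalarAInfty D V * ∫⁻ x, ‖f x‖ₑ ^ 2 with hC
  have hCt : C ≠ ∞ := by finiteness
  have hfin : ∀ s : Finset S, ∫⁻ x, (∑ Q ∈ s, (Q : Set (EuclideanSpace ℝ (Fin N))).indicator
      (fun x => ⨍⁻ y in (Q : Set (EuclideanSpace ℝ (Fin N))),
        ENNReal.ofReal (‖CFC.sqrt (V x) * CFC.sqrt (W y)‖ * |f y|) ∂volume) x) ^ 2 ≤
        jointA2 D W V * C := by
    intro s
    refine ENNReal.le_of_forall_pos_le_add fun η hη _ => ?_
    set F := s.map (Function.Embedding.subtype _) with hFdef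
    have hFS : (F : Set (Set (EuclideanSpace ℝ (Fin N)))) ⊆ S := by
      intro Q hQ
      obtain ⟨R, _, rfl⟩ := Finset.mem_map.1 (Finset.mem_coe.1 hQ)
      exact R.2
    -- The error `η C/(C+1)` stays below `η`; the `+ 1` covers `C = 0`.
    have hδ : (0 : ℝ) < η / (C.toReal + 1) := by positivity
    have h := lintegral_sq_sum_le hN hV hW hAV hAW hJ ENNReal.ofReal_ne_top
      (fun Q hQ => hSD (hFS hQ)) (hS.sum_le hFS) hf hf2 hδ
    simp only [hFdef, Finset.sum_map, Function.Embedding.coe_subtype] at h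
    refine h.trans ?_
    calc (jointA2 D W V + ENNReal.ofReal (η / (C.toReal + 1))) *
          (64 * 2 ^ N * d * ENNReal.ofReal lam) ^ 2 * scalarAInfty D W * scalarAInfty D V *
          ∫⁻ x, ‖f x‖ₑ ^ 2
        = jointA2 D W V * C + ENNReal.ofReal (η / (C.toReal + 1)) * C := by rw [hC]; ring
      _ ≤ jointA2 D W V * C + η := by
          gcongr
          nth_rewrite 2 [← ENNReal.ofReal_toReal hCt]
          rw [← ENNReal.ofReal_mul hδ.le, ← ENNReal.ofReal_coe_nnreal]
          refine ENNReal.ofReal_le_ofReal ?_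
          have hC0 : 0 ≤ C.toReal := ENNReal.toReal_nonneg
          rw [div_mul_eq_mul_div, div_le_iff₀ (by positivity)]
          have : (0 : ℝ) ≤ η := η.2
          nlinarith
  have hcount : Countable S := (D.countable_cubes.mono hSD).to_subtype
  have hsup : ∀ x, scalarLerner S V W f x ^ 2 = ⨆ s : Finset S,
      (∑ Q ∈ s, (Q : Set (EuclideanSpace ℝ (Fin N))).indicator
      (fun x => ⨍⁻ y in (Q : Set (EuclideanSpace ℝ (Fin N))),
        ENNReal.ofReal (‖CFC.sqrt (V x) * CFC.sqrt (W y)‖ * |f y|) ∂volume) x) ^ 2 := by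
    intro x
    rw [scalarLerner, ENNReal.tsum_eq_iSup_sum]
    simp_rw [← ENNReal.rpow_two]
    exact (ENNReal.orderIsoRpow 2 (by norm_num)).map_iSup _
  simp_rw [hsup]
  -- Monotone convergence over the finite subfamilies; this directed form requires `S` to be
  -- countable.
  rw [lintegral_iSup_directed]
  · refine (iSup_le hfin).trans (le_of_eq ?_)
    rw [hC]
    ring
  · intro s
    refine (Finset.aemeasurable_fun_sum _ fun Q _ => ?_).pow_const 2
    exact (aemeasurable_setLAverage_norm_sqrt_mul_sqrt hV hW hf _).indicator
      (D.measurableSet_of_mem (hSD Q.2))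
  · have hmono : Monotone fun (s : Finset S) (x : EuclideanSpace ℝ (Fin N)) =>
        (∑ Q ∈ s, (Q : Set (EuclideanSpace ℝ (Fin N))).indicator
        (fun x => ⨍⁻ y in (Q : Set (EuclideanSpace ℝ (Fin N))),
          ENNReal.ofReal (‖CFC.sqrt (V x) * CFC.sqrt (W y)‖ * |f y|) ∂volume) x) ^ 2 := by
      intro s t hst x
      exact pow_le_pow_left' (Finset.sum_le_sum_of_subset hst) 2
    exact hmono.directed_le

theorem memLp_scalarLerner_and_eLpNorm_le (hN : 1 ≤ N) (hV : IsMatrixWeight V)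
    (hW : IsMatrixWeight W) (hAV : scalarAInfty D V ≠ ∞) (hAW : scalarAInfty D W ≠ ∞)
    (hJ : jointA2 D W V ≠ ∞) (hSD : S ⊆ D.cubes) {lam : ℝ} (hS : IsDyadicCarleson lam S)
    {f : EuclideanSpace ℝ (Fin N) → ℝ} (hf : MemLp f 2 volume) :
    MemLp (scalarLerner S V W f) 2 volume ∧
      eLpNorm (scalarLerner S V W f) 2 volume ≤
        ENNReal.ofReal (64 * lam * 2 ^ N * d) * jointA2 D W V ^ (1 / 2 : ℝ) *
          scalarAInfty D W ^ (1 / 2 : ℝ) * scalarAInfty D V ^ (1 / 2 : ℝ) *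
          eLpNorm f 2 volume := by
  have hfm : AEMeasurable f := hf.1.aemeasurable
  have hnorm : eLpNorm f 2 volume = (∫⁻ x, ‖f x‖ₑ ^ 2) ^ (1 / 2 : ℝ) := by
    rw [eLpNorm_eq_lintegral_rpow_enorm_toReal (by norm_num) (by norm_num)]
    simp
  have hnormL : eLpNorm (scalarLerner S V W f) 2 volume =
      (∫⁻ x, scalarLerner S V W f x ^ 2) ^ (1 / 2 : ℝ) := by
    rw [eLpNorm_eq_lintegral_rpow_enorm_toReal (by norm_num) (by norm_num)]
    simp
  have hf2 : ∫⁻ x, ‖f x‖ₑ ^ 2 ≠ ∞ := by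
    intro h
    have := hf.2
    rw [hnorm, h, ENNReal.top_rpow_of_pos (by norm_num)] at this
    exact lt_irrefl _ this
  have hbound : eLpNorm (scalarLerner S V W f) 2 volume ≤
        ENNReal.ofReal (64 * lam * 2 ^ N * d) * jointA2 D W V ^ (1 / 2 : ℝ) *
          scalarAInfty D W ^ (1 / 2 : ℝ) * scalarAInfty D V ^ (1 / 2 : ℝ) *
          eLpNorm f 2 volume := by
    rw [hnorm, hnormL]
    refine (ENNReal.rpow_le_rpow (lintegral_scalarLerner_sq_le hN hV hW hAV hAW hJ hSD hS hfm hf2)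
      (by norm_num)).trans (le_of_eq ?_)
    have h3 : ∀ a : ℝ≥0∞, (a ^ 2) ^ (1 / 2 : ℝ) = a := by
      intro a
      rw [← ENNReal.rpow_two, ← ENNReal.rpow_mul]
      norm_num
    have hc : (64 * 2 ^ N * d * ENNReal.ofReal lam : ℝ≥0∞) =
        ENNReal.ofReal (64 * lam * 2 ^ N * d) := by
      rw [show 64 * lam * 2 ^ N * (d : ℝ) = 64 * 2 ^ N * d * lam by ring,
        ENNReal.ofReal_mul (by positivity), ENNReal.ofReal_mul (by positivity),
        ENNReal.ofReal_mul (by norm_num), ENNReal.ofReal_pow (by norm_num)]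
      simp
    rw [ENNReal.mul_rpow_of_nonneg _ _ (by norm_num), ENNReal.mul_rpow_of_nonneg _ _ (by norm_num),
      ENNReal.mul_rpow_of_nonneg _ _ (by norm_num), ENNReal.mul_rpow_of_nonneg _ _ (by norm_num),
      h3, hc]
    ring
  refine ⟨⟨?_, hbound.trans_lt ?_⟩, hbound⟩
  · have hcount : Countable S := (D.countable_cubes.mono hSD).to_subtype
    have hm : AEMeasurable (scalarLerner S V W f) := by
      refine AEMeasurable.tsum fun Q => ?_
      exact (aemeasurable_setLAverage_norm_sqrt_mul_sqrt hV hW hfm _).indicator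
        (D.measurableSet_of_mem (hSD Q.2))
    exact hm.aestronglyMeasurable
  · have h1 : ∀ a : ℝ≥0∞, a ≠ ∞ → a ^ (1 / 2 : ℝ) ≠ ∞ := fun a ha =>
      ENNReal.rpow_ne_top_of_nonneg (by norm_num) ha
    exact (ENNReal.mul_ne_top (ENNReal.mul_ne_top (ENNReal.mul_ne_top (ENNReal.mul_ne_top
      ENNReal.ofReal_ne_top (h1 _ hJ)) (h1 _ hAW)) (h1 _ hAV)) hf.2.ne).lt_top

end Operator

theorem lemma5p5 :
    ∃ C : ℝ, 0 < C ∧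
      ∀ (𝕜 : Type) [RCLike 𝕜] (N d : ℕ), 1 ≤ N →
      ∀ (D : DyadicLattice N) (V W : EuclideanSpace ℝ (Fin N) → Matrix (Fin d) (Fin d) 𝕜),
        IsMatrixWeight V → IsMatrixWeight W →
        jointA2 D W V < ∞ → scalarAInfty D W < ∞ → scalarAInfty D V < ∞ →
      ∀ S : Set (Set (EuclideanSpace ℝ (Fin N))), S ⊆ D.cubes →
        (∀ κ : ℝ, 0 < κ → κ < 1 → IsClassicallySparse κ S →
          ∀ f : EuclideanSpace ℝ (Fin N) → ℝ, MemLp f 2 volume →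
            MemLp (scalarLerner S V W f) 2 volume ∧
            eLpNorm (scalarLerner S V W f) 2 volume ≤
              ENNReal.ofReal (C / (1 - κ) * 2 ^ N * d) * jointA2 D W V ^ (1 / 2 : ℝ) *
                scalarAInfty D W ^ (1 / 2 : ℝ) * scalarAInfty D V ^ (1 / 2 : ℝ) *
                eLpNorm f 2 volume) ∧
        (∀ lam : ℝ, 0 < lam → IsDyadicCarleson lam S →
          ∀ f : EuclideanSpace ℝ (Fin N) → ℝ, MemLp f 2 volume →
            MemLp (scalarLerner S V W f) 2 volume ∧
            eLpNorm (scalarLerner S V W f) 2 volume ≤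
              ENNReal.ofReal (C * lam * 2 ^ N * d) * jointA2 D W V ^ (1 / 2 : ℝ) *
                scalarAInfty D W ^ (1 / 2 : ℝ) * scalarAInfty D V ^ (1 / 2 : ℝ) *
                eLpNorm f 2 volume) := by
  refine ⟨64, by norm_num, fun 𝕜 _ N d hN D V W hV hW hJ hAW hAV S hSD => ⟨?_, ?_⟩⟩
  · intro κ hκ0 hκ1 hS f hf
    rw [div_eq_mul_one_div (64 : ℝ)]
    exact memLp_scalarLerner_and_eLpNorm_le hN hV hW hAV.ne hAW.ne hJ.ne hSD
      (hS.isDyadicCarleson hκ0 hκ1 hSD) hf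
  · intro lam _ hS f hf
    exact memLp_scalarLerner_and_eLpNorm_le hN hV hW hAV.ne hAW.ne hJ.ne hSD hS hf
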